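/- Let $\mathbb D$ be the open unit disc and $\mathcal D$ the Dirichlet space of analytic functions $f$ on $\mathbb D$ with $\|f\|_{\mathcal D}^2 = |f(0)|^2 + \int_{\mathbb D} |f'|^2\, dA < \infty$, where $A$ is normalized Lebesgue area measure on $\mathbb D$. Let $\mathcal M(\mathcal D)$ be the set of multipliers of $\mathcal D$, that is, of functions $u$ on $\mathbb D$ with $uf \in \mathcal D$ for every $f \in \mathcal D$. Let $\varphi$ be a parabolic automorphism of $\mathbb D$ with fixed point $a$, that is, $\varphi(z) = e^{i\theta}\,\dfrac{p-z}{1-\overline{p}z}$ with $p \in \mathbb D$, $-\pi < \theta \le \pi$ and $|p| = \cos(\theta/2)$, where $a$, $|a| = 1$, is the only fixed point of $\varphi$ in $\overline{\mathbb D}$ (so $\varphi$ is not the identity). Let $h \in \mathcal M(\mathcal D)$ be continuous at $a$, that is, $h(z)$ has a finite limit $h(a)$ as $z \to a$, $z \in \mathbb D$. Let $W_{h,\varphi}$ be the bounded weighted composition operator $W_{h,\varphi} f = h\,(f\circ\varphi)$ on $\mathcal D$. If $W_{h,\varphi}$ is invertible, then its spectrum is $$\sigma(W_{h,\varphi}) =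 \{\lambda \in \mathbb C : |\lambda| = |h(a)|\}.$$ -/

import Mathlib

open Complex Complex.UnitDisc MeasureTheory Filter Topology
open scoped ComplexConjugate

noncomputable section

/-- A function on the unit disc, regarded as a function on `ℂ` (extended by `0` off the disc). -/
def discExt (f : 𝔻 → ℂ) (z : ℂ) : ℂ :=
  if hz : ‖z‖ < 1 then f (UnitDisc.mk z hz) else 0

/-- `f` is analytic on the open unit disc. -/
def IsAnalyticOnDisc (f : 𝔻 → ℂ) : Prop :=
  DifferentiableOn ℂ (discExt f) (Metric.ball 0 1)

/-- The complex derivative `f'`, as a function on `ℂ` (only its values on the disc matter). -/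
def discDeriv (f : 𝔻 → ℂ) : ℂ → ℂ := deriv (discExt f)

/-- Normalized Lebesgue area measure of the unit disc (total mass `1`). -/
def discArea : Measure ℂ :=
  (ENNReal.ofReal Real.pi)⁻¹ • volume.restrict (Metric.ball (0 : ℂ) 1)

/-- `f` belongs to the Dirichlet space: `f` is analytic on the disc and `∫ |f'|² dA < ∞`. -/
def IsDirichlet (f : 𝔻 → ℂ) : Prop :=
  IsAnalyticOnDisc f ∧ MemLp (discDeriv f) 2 discArea

lemma discExt_coe (f : 𝔻 → ℂ) (z : 𝔻) : discExt f z = f z := by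
  simp [discExt, z.norm_lt_one]

lemma discExt_add (f g : 𝔻 → ℂ) : discExt (f + g) = discExt f + discExt g := by
  ext z
  by_cases hz : ‖z‖ < 1 <;> simp [discExt, hz]

lemma discExt_smul (c : ℂ) (f : 𝔻 → ℂ) : discExt (c • f) = c • discExt f := by
  ext z
  by_cases hz : ‖z‖ < 1 <;> simp [discExt, hz]

lemma ae_discArea_of_ball {p : ℂ → Prop} (hp : ∀ z ∈ Metric.ball (0 : ℂ) 1, p z) :
    ∀ᵐ z ∂discArea, p z := by
  refine Measure.ae_smul_measure ?_ _
  exact ae_restrict_of_forall_mem Metric.isOpen_ball.measurableSet hp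

lemma IsAnalyticOnDisc.differentiableAt {f : 𝔻 → ℂ} (hf : IsAnalyticOnDisc f) {z : ℂ}
    (hz : z ∈ Metric.ball (0 : ℂ) 1) : DifferentiableAt ℂ (discExt f) z :=
  DifferentiableOn.differentiableAt hf (Metric.isOpen_ball.mem_nhds hz)

lemma discDeriv_add_ae {f g : 𝔻 → ℂ} (hf : IsAnalyticOnDisc f) (hg : IsAnalyticOnDisc g) :
    discDeriv (f + g) =ᵐ[discArea] discDeriv f + discDeriv g := by
  refine ae_discArea_of_ball fun z hz => ?_
  simp only [discDeriv, discExt_add, Pi.add_apply]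
  exact deriv_add (hf.differentiableAt hz) (hg.differentiableAt hz)

lemma discDeriv_smul (c : ℂ) (f : 𝔻 → ℂ) : discDeriv (c • f) = c • discDeriv f := by
  ext z
  simp only [discDeriv, discExt_smul, Pi.smul_apply]
  exact deriv_const_smul_field c (discExt f)

/-- The Dirichlet space as a linear subspace of the functions on the disc. -/
def dirichletSubmodule : Submodule ℂ (𝔻 → ℂ) where
  carrier := {f | IsDirichlet f}
  add_mem' := by
    intro f g hf hg
    refine ⟨?_, ?_⟩
    · simp only [IsAnalyticOnDisc, discExt_add]
      exact DifferentiableOn.add hf.1 hg.1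
    · exact (memLp_congr_ae (discDeriv_add_ae hf.1 hg.1)).2 (hf.2.add hg.2)
  zero_mem' := by
    have h0 : discExt 0 = fun _ => (0 : ℂ) := by
      ext z
      by_cases hz : ‖z‖ < 1 <;> simp [discExt, hz]
    refine ⟨?_, ?_⟩
    · simp only [IsAnalyticOnDisc, h0]
      exact differentiableOn_const 0
    · have h1 : discDeriv 0 = fun _ => (0 : ℂ) := by
        ext z
        simp [discDeriv, h0]
      rw [h1]
      exact MemLp.zero
  smul_mem' := by
    intro c f hf
    refine ⟨?_, ?_⟩
    · simp only [IsAnalyticOnDisc, discExt_smul]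
      exact DifferentiableOn.const_smul hf.1 c
    · rw [discDeriv_smul]
      exact hf.2.const_smul c

/-- The Dirichlet space of the unit disc. It is a separate type, so that its topology is the one
of the Dirichlet norm and not that of pointwise convergence. -/
def DirichletSpace : Type := dirichletSubmodule

namespace DirichletSpace

instance : AddCommGroup DirichletSpace := inferInstanceAs (AddCommGroup dirichletSubmodule)

instance : Module ℂ DirichletSpace := inferInstanceAs (Module ℂ dirichletSubmodule)

instance : CoeFun DirichletSpace (fun _ => 𝔻 → ℂ) := ⟨Subtype.val⟩

lemma isDirichlet (f : DirichletSpace) : IsDirichlet f := f.2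

lemma coe_add (f g : DirichletSpace) : ((f + g : DirichletSpace) : 𝔻 → ℂ) = f + g := rfl

lemma coe_smul (c : ℂ) (f : DirichletSpace) : ((c • f : DirichletSpace) : 𝔻 → ℂ) = c • f := rfl

lemma integrable_inner (f g : DirichletSpace) :
    Integrable (fun z => conj (discDeriv f z) * discDeriv g z) discArea :=
  f.isDirichlet.2.star.integrable_mul g.isDirichlet.2

/-- The inner product `⟪f, g⟫ = conj (f 0) * g 0 + ∫ conj f' * g' dA`, whose norm is
`‖f‖² = |f 0|² + ∫ |f'|² dA`. -/
@[reducible] def core : InnerProductSpace.Core ℂ DirichletSpace where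
  inner f g := conj (f 0) * g 0 + ∫ z, conj (discDeriv f z) * discDeriv g z ∂discArea
  conj_inner_symm f g := by
    simp only [map_add, map_mul, Complex.conj_conj, ← integral_conj]
    congr 1
    · ring
    · congr 1
      ext z
      ring
  re_inner_nonneg f := by
    have h1 : ∀ w : ℂ, conj w * w = ((‖w‖ ^ 2 : ℝ) : ℂ) := by
      intro w
      rw [Complex.conj_mul']
      push_cast
      rfl
    simp only [h1, integral_complex_ofReal]
    rw [← Complex.ofReal_add]
    simp only [RCLike.re_to_complex, Complex.ofReal_re]
    have : 0 ≤ ∫ z, ‖discDeriv f z‖ ^ 2 ∂discArea := integral_nonneg fun z => by positivity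
    positivity
  add_left f g k := by
    have h1 : ∫ z, conj (discDeriv (f + g : DirichletSpace) z) * discDeriv k z ∂discArea
        = ∫ z, (conj (discDeriv f z) * discDeriv k z
            + conj (discDeriv g z) * discDeriv k z) ∂discArea := by
      refine integral_congr_ae ?_
      filter_upwards [discDeriv_add_ae f.isDirichlet.1 g.isDirichlet.1] with z hz
      rw [coe_add, hz, Pi.add_apply, map_add]
      ring
    rw [h1, integral_add (integrable_inner f k) (integrable_inner g k), coe_add, Pi.add_apply,
      map_add]
    ring
  smul_left f g c := by
    simp only [coe_smul, discDeriv_smul, Pi.smul_apply, smul_eq_mul, map_mul, mul_assoc,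
      integral_const_mul]
    ring
  definite f hf := by
    have h1 : ∀ w : ℂ, conj w * w = ((‖w‖ ^ 2 : ℝ) : ℂ) := by
      intro w
      rw [Complex.conj_mul']
      push_cast
      rfl
    have hint : Integrable (fun z => ‖discDeriv f z‖ ^ 2) discArea :=
      f.isDirichlet.2.integrable_norm_pow (by norm_num)
    simp only [h1, integral_complex_ofReal] at hf
    rw [← Complex.ofReal_add, Complex.ofReal_eq_zero] at hf
    have hI : 0 ≤ ∫ z, ‖discDeriv f z‖ ^ 2 ∂discArea := integral_nonneg fun z => by positivity
    have h0 : 0 ≤ ‖f 0‖ ^ 2 := by positivity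
    have hf0 : f 0 = 0 := by
      have : ‖f 0‖ ^ 2 = 0 := by linarith
      simpa using this
    have hI0 : ∫ z, ‖discDeriv f z‖ ^ 2 ∂discArea = 0 := by linarith
    rw [integral_eq_zero_iff_of_nonneg (fun z => by positivity) hint] at hI0
    have hae : discDeriv f =ᵐ[volume.restrict (Metric.ball (0 : ℂ) 1)] fun _ => 0 := by
      have hne : (ENNReal.ofReal Real.pi)⁻¹ ≠ 0 := by simp
      have h2 := (Measure.ae_ennreal_smul_measure_iff hne).1 hI0
      filter_upwards [h2] with z hz
      simpa using hz
    have hcont : ContinuousOn (discDeriv f) (Metric.ball (0 : ℂ) 1) :=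
      (DifferentiableOn.deriv f.isDirichlet.1 Metric.isOpen_ball).continuousOn
    have heq : Set.EqOn (discDeriv f) (fun _ => 0) (Metric.ball (0 : ℂ) 1) :=
      Measure.eqOn_open_of_ae_eq hae Metric.isOpen_ball hcont continuousOn_const
    apply Subtype.ext
    funext z
    have hz : (z : ℂ) ∈ Metric.ball (0 : ℂ) 1 := by simpa using z.norm_lt_one
    have h3 := Metric.isOpen_ball.is_const_of_deriv_eq_zero
      (convex_ball (0 : ℂ) 1).isPreconnected f.isDirichlet.1 heq hz
      (Metric.mem_ball_self one_pos)
    rw [discExt_coe, ← UnitDisc.coe_zero, discExt_coe, hf0] at h3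
    exact h3

instance : NormedAddCommGroup DirichletSpace := core.toNormedAddCommGroup

instance : InnerProductSpace ℂ DirichletSpace := InnerProductSpace.ofCore core.toCore

/-- The norm of the Dirichlet space. -/
lemma norm_sq_eq (f : DirichletSpace) :
    ‖f‖ ^ 2 = ‖f 0‖ ^ 2 + ∫ z, ‖discDeriv f z‖ ^ 2 ∂discArea := by
  have h1 : ∀ w : ℂ, conj w * w = ((‖w‖ ^ 2 : ℝ) : ℂ) := by
    intro w
    rw [Complex.conj_mul']
    push_cast
    rfl
  rw [← inner_self_eq_norm_sq (𝕜 := ℂ)]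
  change RCLike.re (conj (f 0) * f 0 + ∫ z, conj (discDeriv f z) * discDeriv f z ∂discArea) = _
  simp only [h1, integral_complex_ofReal]
  rw [← Complex.ofReal_add, RCLike.re_to_complex, Complex.ofReal_re]

end DirichletSpace

/-- `u` is a multiplier of the Dirichlet space: `f ↦ u f` is defined everywhere on the space. -/
def IsDirichletMultiplier (u : 𝔻 → ℂ) : Prop :=
  ∀ f : 𝔻 → ℂ, IsDirichlet f → IsDirichlet (u * f)

/-- `W` is the weighted composition operator `f ↦ h · (f ∘ φ)`. -/
def IsWeightedComposition (h : 𝔻 → ℂ) (φ : 𝔻 → 𝔻)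
    (W : DirichletSpace →L[ℂ] DirichletSpace) : Prop :=
  ∀ (f : DirichletSpace) (z : 𝔻), W f z = h z * f (φ z)

/-- The Möbius map `z ↦ e^{iθ} (p - z) / (1 - p̄ z)`. -/
def discAut (θ : ℝ) (p z : ℂ) : ℂ :=
  Complex.exp (θ * Complex.I) * ((p - z) / (1 - conj p * z))

/-- `φ` is a parabolic automorphism of the disc with fixed point `a`: it is
`z ↦ e^{iθ} (p - z) / (1 - p̄ z)` with `p ∈ 𝔻`, `-π < θ ≤ π` and `|p| = cos (θ / 2)`, and its only
fixed point in the closed disc is the point `a` of the unit circle. The clause on fixed points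
excludes the identity (`p = 0`, `θ = π`). -/
def IsParabolicAut (φ : 𝔻 → 𝔻) (a : ℂ) : Prop :=
  ∃ (p : 𝔻) (θ : ℝ), -Real.pi < θ ∧ θ ≤ Real.pi ∧ (∀ z : 𝔻, (φ z : ℂ) = discAut θ p z) ∧
    ‖(p : ℂ)‖ = Real.cos (θ / 2) ∧ ‖a‖ = 1 ∧ ∀ w : ℂ, ‖w‖ ≤ 1 → (discAut θ p w = w ↔ w = a)

/-- `h` is continuous at the boundary point `a` with value `c`, that is, `h(z) → c` as `z → a`
within the disc. -/
def HasBoundaryValue (h : 𝔻 → ℂ) (a c : ℂ) : Prop :=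
  Tendsto h (comap (fun z : 𝔻 => (z : ℂ)) (𝓝 a)) (𝓝 c)

end

/-!
The point of passing to the half-plane is that, in the coordinate `w = (a + z) / (a - z)`, a
parabolic automorphism with fixed point `a` is a translation `w ↦ w + b i` with `b ≠ 0`
(`IsParabolicAut.exists_parabolic`), and that `z → a` means `|w| → ∞`. Write `φ` for the
automorphism, `W` for the operator with weight `h`, and `c` for the boundary value of `h` at `a`.
The seminorm `‖f'‖` of the Dirichlet space, an area integral over the disc, is invariant under
composition with `φ` (`isBergman_and_bergmanNorm_comp`).

*The spectrum lies in the circle.* An orbit of `φ` meets a region `|w| < R` a bounded number of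
times, uniformly in the starting point, so `∏_{j ∈ s} |h ∘ φ^j| ≤ K ρ ^ |s|` for each `ρ > |c|`
(`exists_norm_prod_le`). Moreover `‖h' f‖ ≤ B ‖f‖`, because multiplication by `h` is bounded on
the Dirichlet space and a multiplier is a bounded function
(`IsWeightedComposition.exists_weight_bounds`). In the derivative of
`W ^ n f = (∏_{j < n} h ∘ φ^j) (f ∘ φ^n)`, the term that contains `(h ∘ φ^j)'` is carried back by
`φ^j` to `h' (f ∘ φ^(n - j))`; since `‖f ∘ φ^n‖` grows at most linearly, this gives
`‖W ^ n‖ ≤ C (n + 1)² ρ ^ n` (`IsWeightedComposition.exists_norm_pow_le`), hence `|λ| ≤ |c|` on the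
spectrum. The inverse of `W` is the weighted composition operator with symbol `φ⁻¹` and a weight
that tends to `1 / c` at `a`, so also `|λ| ≥ |c|`.

*The circle lies in the spectrum.* The functions `exp (-s w)`, `s > 0`, satisfy
`G ∘ φ = exp (-i s b) G`, but they are not in the Dirichlet space
(`not_isBergman_dDeriv_innerFn`). The functions `g = exp (-s w) / (1 + δ w)²` are in it; they are
bounded by `1`, and `‖g'‖` is unbounded as `δ → 0` by Fatou's lemma. In `(W - c exp (-i s b)) g`
all terms are bounded or small compared with `‖g'‖`
(`IsWeightedComposition.exists_norm_residual_le`): where `h` is differentiated one uses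
`|g| ≤ 1`, and `|h - c|` is small where most of the mass of `g'` lies. So `c exp (-i s b)` is an
approximate eigenvalue, and these points fill the circle.
-/

noncomputable section

/-! ### Analytic functions on the disc -/

/-- The derivative of a function on the disc, as a function on the disc. -/
def dDeriv (f : 𝔻 → ℂ) (z : 𝔻) : ℂ := discDeriv f z

lemma coe_mem_ball (z : 𝔻) : (z : ℂ) ∈ Metric.ball (0 : ℂ) 1 := by
  simpa using z.norm_lt_one

lemma forall_mem_ball {p : ℂ → Prop} (hp : ∀ z : 𝔻, p z) : ∀ z ∈ Metric.ball (0 : ℂ) 1, p z := by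
  intro z hz
  exact hp (UnitDisc.mk z (by simpa using hz))

lemma discExt_eventuallyEq {f : 𝔻 → ℂ} {F : ℂ → ℂ} (hF : ∀ z : 𝔻, f z = F z) (z : 𝔻) :
    discExt f =ᶠ[𝓝 (z : ℂ)] F := by
  filter_upwards [Metric.isOpen_ball.mem_nhds (coe_mem_ball z)] with x hx
  revert x
  refine forall_mem_ball fun x => ?_
  rw [discExt_coe, hF]

lemma IsAnalyticOnDisc.hasDerivAt {f : 𝔻 → ℂ} (hf : IsAnalyticOnDisc f) (z : 𝔻) :
    HasDerivAt (discExt f) (dDeriv f z) z :=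
  (hf.differentiableAt (coe_mem_ball z)).hasDerivAt

lemma isAnalyticOnDisc_of_hasDerivAt {f : 𝔻 → ℂ} {F : ℂ → ℂ} {F' : 𝔻 → ℂ}
    (hF : ∀ z : 𝔻, f z = F z) (hd : ∀ z : 𝔻, HasDerivAt F (F' z) z) :
    IsAnalyticOnDisc f := by
  refine forall_mem_ball fun z => ?_
  exact ((hd z).congr_of_eventuallyEq
    (discExt_eventuallyEq hF z)).differentiableAt.differentiableWithinAt

lemma dDeriv_eq_of_hasDerivAt {f : 𝔻 → ℂ} {F : ℂ → ℂ} {c : ℂ} {z : 𝔻}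
    (hF : ∀ z : 𝔻, f z = F z) (hd : HasDerivAt F c z) : dDeriv f z = c :=
  (hd.congr_of_eventuallyEq (discExt_eventuallyEq hF z)).deriv

lemma IsAnalyticOnDisc.dDeriv {f : 𝔻 → ℂ} (hf : IsAnalyticOnDisc f) :
    IsAnalyticOnDisc (dDeriv f) := by
  have h1 : DifferentiableOn ℂ (deriv (discExt f)) (Metric.ball 0 1) :=
    DifferentiableOn.deriv hf Metric.isOpen_ball
  exact isAnalyticOnDisc_of_hasDerivAt (F := deriv (discExt f)) (fun z => rfl)
    fun z => (h1.differentiableAt (Metric.isOpen_ball.mem_nhds (coe_mem_ball z))).hasDerivAt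

section

variable {f g : 𝔻 → ℂ}

lemma isAnalyticOnDisc_const (c : ℂ) : IsAnalyticOnDisc fun _ => c :=
  isAnalyticOnDisc_of_hasDerivAt (F := fun _ => c) (fun _ => rfl) fun _ => hasDerivAt_const _ _

lemma dDeriv_const (c : ℂ) : dDeriv (fun _ => c) = 0 := by
  funext z
  exact dDeriv_eq_of_hasDerivAt (F := fun _ => c) (fun _ => rfl) (hasDerivAt_const _ _)

lemma hasDerivAt_discExt_add (hf : IsAnalyticOnDisc f) (hg : IsAnalyticOnDisc g) (z : 𝔻) :
    HasDerivAt (discExt f + discExt g) (dDeriv f z + dDeriv g z) z :=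
  (hf.hasDerivAt z).add (hg.hasDerivAt z)

lemma IsAnalyticOnDisc.add (hf : IsAnalyticOnDisc f) (hg : IsAnalyticOnDisc g) :
    IsAnalyticOnDisc (f + g) :=
  isAnalyticOnDisc_of_hasDerivAt (fun z => by simp [discExt_coe]) (hasDerivAt_discExt_add hf hg)

lemma dDeriv_add (hf : IsAnalyticOnDisc f) (hg : IsAnalyticOnDisc g) :
    dDeriv (f + g) = dDeriv f + dDeriv g := by
  funext z
  exact dDeriv_eq_of_hasDerivAt (fun z => by simp [discExt_coe]) (hasDerivAt_discExt_add hf hg z)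

lemma hasDerivAt_discExt_mul (hf : IsAnalyticOnDisc f) (hg : IsAnalyticOnDisc g) (z : 𝔻) :
    HasDerivAt (discExt f * discExt g) (dDeriv f z * g z + f z * dDeriv g z) z := by
  simpa [discExt_coe] using (hf.hasDerivAt z).mul (hg.hasDerivAt z)

lemma IsAnalyticOnDisc.mul (hf : IsAnalyticOnDisc f) (hg : IsAnalyticOnDisc g) :
    IsAnalyticOnDisc (f * g) :=
  isAnalyticOnDisc_of_hasDerivAt (fun z => by simp [discExt_coe]) (hasDerivAt_discExt_mul hf hg)

lemma dDeriv_mul (hf : IsAnalyticOnDisc f) (hg : IsAnalyticOnDisc g) :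
    dDeriv (f * g) = dDeriv f * g + f * dDeriv g := by
  funext z
  exact dDeriv_eq_of_hasDerivAt (fun z => by simp [discExt_coe]) (hasDerivAt_discExt_mul hf hg z)

lemma IsAnalyticOnDisc.smul (hf : IsAnalyticOnDisc f) (c : ℂ) : IsAnalyticOnDisc (c • f) :=
  (isAnalyticOnDisc_const c).mul hf

lemma dDeriv_smul (c : ℂ) : dDeriv (c • f) = c • dDeriv f := by
  funext z
  simp [dDeriv, discDeriv_smul]

lemma IsAnalyticOnDisc.neg (hf : IsAnalyticOnDisc f) : IsAnalyticOnDisc (-f) := by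
  simpa using hf.smul (-1)

lemma IsAnalyticOnDisc.sub (hf : IsAnalyticOnDisc f) (hg : IsAnalyticOnDisc g) :
    IsAnalyticOnDisc (f - g) := by
  simpa [sub_eq_add_neg] using hf.add hg.neg

lemma dDeriv_neg : dDeriv (-f) = -dDeriv f := by
  simpa using dDeriv_smul (f := f) (-1)

lemma dDeriv_sub (hf : IsAnalyticOnDisc f) (hg : IsAnalyticOnDisc g) :
    dDeriv (f - g) = dDeriv f - dDeriv g := by
  rw [sub_eq_add_neg, dDeriv_add hf hg.neg, dDeriv_neg, sub_eq_add_neg]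

lemma IsAnalyticOnDisc.prod {ι : Type*} {u : ι → 𝔻 → ℂ} {s : Finset ι}
    (hu : ∀ i ∈ s, IsAnalyticOnDisc (u i)) : IsAnalyticOnDisc (∏ i ∈ s, u i) :=
  Finset.prod_induction u IsAnalyticOnDisc (fun _ _ => IsAnalyticOnDisc.mul)
    (isAnalyticOnDisc_const 1) hu

lemma dDeriv_prod {ι : Type*} [DecidableEq ι] {u : ι → 𝔻 → ℂ} {s : Finset ι}
    (hu : ∀ i, IsAnalyticOnDisc (u i)) :
    dDeriv (∏ i ∈ s, u i) = ∑ i ∈ s, (∏ j ∈ s.erase i, u j) * dDeriv (u i) := by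
  funext z
  have h1 := HasDerivAt.finsetProd (u := s) (f := fun i => discExt (u i))
    (f' := fun i => dDeriv (u i) z) fun i _ => (hu i).hasDerivAt z
  rw [dDeriv_eq_of_hasDerivAt (fun z => by simp [discExt_coe, Finset.prod_apply]) h1]
  simp [discExt_coe, Finset.prod_apply, Finset.sum_apply]

/-- A self-map of the disc, regarded as a complex-valued function. -/
def coeMap (φ : 𝔻 → 𝔻) (z : 𝔻) : ℂ := φ z

variable {φ : 𝔻 → 𝔻}

lemma hasDerivAt_discExt_comp (hf : IsAnalyticOnDisc f) (hφ : IsAnalyticOnDisc (coeMap φ))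
    (z : 𝔻) :
    HasDerivAt (discExt f ∘ discExt (coeMap φ)) (dDeriv f (φ z) * dDeriv (coeMap φ) z) z := by
  refine HasDerivAt.comp (z : ℂ) ?_ (hφ.hasDerivAt z)
  rw [discExt_coe]
  exact hf.hasDerivAt (φ z)

lemma discExt_comp_apply (z : 𝔻) : (f ∘ φ) z = (discExt f ∘ discExt (coeMap φ)) z := by
  simp only [Function.comp_apply, discExt_coe]
  exact (discExt_coe f (φ z)).symm

lemma IsAnalyticOnDisc.comp (hf : IsAnalyticOnDisc f) (hφ : IsAnalyticOnDisc (coeMap φ)) :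
    IsAnalyticOnDisc (f ∘ φ) :=
  isAnalyticOnDisc_of_hasDerivAt discExt_comp_apply (hasDerivAt_discExt_comp hf hφ)

lemma dDeriv_comp (hf : IsAnalyticOnDisc f) (hφ : IsAnalyticOnDisc (coeMap φ)) :
    dDeriv (f ∘ φ) = (dDeriv f ∘ φ) * dDeriv (coeMap φ) := by
  funext z
  exact dDeriv_eq_of_hasDerivAt discExt_comp_apply (hasDerivAt_discExt_comp hf hφ z)

end

/-! ### The Bergman space -/

instance : IsProbabilityMeasure discArea := by
  constructor
  have h1 : ENNReal.ofReal Real.pi ≠ 0 := by simpa using Real.pi_pos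
  simp only [discArea, Measure.smul_apply, Measure.restrict_apply_univ, Complex.volume_ball,
    smul_eq_mul, ENNReal.ofReal_one, one_pow, one_mul]
  have h2 : (NNReal.pi : ENNReal) = ENNReal.ofReal Real.pi := by
    rw [← NNReal.coe_real_pi, ENNReal.ofReal_coe_nnreal]
  rw [h2]
  exact ENNReal.inv_mul_cancel h1 ENNReal.ofReal_ne_top

lemma lintegral_discArea (F : ℂ → ENNReal) :
    ∫⁻ z, F z ∂discArea = (ENNReal.ofReal Real.pi)⁻¹ * ∫⁻ z in Metric.ball 0 1, F z := by
  simp [discArea, lintegral_smul_measure]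

lemma IsAnalyticOnDisc.aestronglyMeasurable {u : 𝔻 → ℂ} (hu : IsAnalyticOnDisc u) :
    AEStronglyMeasurable (discExt u) discArea :=
  ((DifferentiableOn.continuousOn hu).aestronglyMeasurable
    Metric.isOpen_ball.measurableSet).smul_measure _

/-- The Bergman space: the analytic functions on the disc that are square integrable. -/
def IsBergman (u : 𝔻 → ℂ) : Prop := IsAnalyticOnDisc u ∧ MemLp (discExt u) 2 discArea

/-- The `L²` norm of a function on the disc with respect to normalized area. -/
def bergmanNorm (u : 𝔻 → ℂ) : ℝ := (eLpNorm (discExt u) 2 discArea).toReal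

lemma bergmanNorm_nonneg (u : 𝔻 → ℂ) : 0 ≤ bergmanNorm u := ENNReal.toReal_nonneg

lemma discDeriv_ae_eq (f : 𝔻 → ℂ) : discDeriv f =ᵐ[discArea] discExt (dDeriv f) := by
  refine ae_discArea_of_ball (forall_mem_ball fun z => ?_)
  rw [discExt_coe, dDeriv]

lemma isDirichlet_iff {f : 𝔻 → ℂ} :
    IsDirichlet f ↔ IsAnalyticOnDisc f ∧ IsBergman (dDeriv f) := by
  rw [IsDirichlet, IsBergman, memLp_congr_ae (discDeriv_ae_eq f)]
  exact ⟨fun h => ⟨h.1, h.1.dDeriv, h.2⟩, fun h => ⟨h.1, h.2.2⟩⟩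

lemma IsBergman.add {u v : 𝔻 → ℂ} (hu : IsBergman u) (hv : IsBergman v) : IsBergman (u + v) :=
  ⟨hu.1.add hv.1, by rw [discExt_add]; exact hu.2.add hv.2⟩

lemma bergmanNorm_add_le {u v : 𝔻 → ℂ} (hu : IsBergman u) (hv : IsBergman v) :
    bergmanNorm (u + v) ≤ bergmanNorm u + bergmanNorm v := by
  rw [bergmanNorm, bergmanNorm, bergmanNorm, discExt_add,
    ← ENNReal.toReal_add hu.2.eLpNorm_ne_top hv.2.eLpNorm_ne_top]
  exact ENNReal.toReal_mono (ENNReal.add_ne_top.2 ⟨hu.2.eLpNorm_ne_top, hv.2.eLpNorm_ne_top⟩)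
    (eLpNorm_add_le hu.2.1 hv.2.1 (by norm_num))

lemma IsBergman.smul {u : 𝔻 → ℂ} (hu : IsBergman u) (c : ℂ) : IsBergman (c • u) :=
  ⟨hu.1.smul c, by rw [discExt_smul]; exact hu.2.const_smul c⟩

lemma bergmanNorm_smul (c : ℂ) (u : 𝔻 → ℂ) : bergmanNorm (c • u) = ‖c‖ * bergmanNorm u := by
  rw [bergmanNorm, bergmanNorm, discExt_smul, eLpNorm_const_smul, ENNReal.toReal_mul]
  simp

lemma bergmanNorm_neg (u : 𝔻 → ℂ) : bergmanNorm (-u) = bergmanNorm u := by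
  simpa using bergmanNorm_smul (-1) u

lemma IsBergman.neg {u : 𝔻 → ℂ} (hu : IsBergman u) : IsBergman (-u) := by
  simpa using hu.smul (-1)

lemma IsBergman.sub {u v : 𝔻 → ℂ} (hu : IsBergman u) (hv : IsBergman v) : IsBergman (u - v) := by
  simpa [sub_eq_add_neg] using hu.add hv.neg

lemma bergmanNorm_sub_le {u v : 𝔻 → ℂ} (hu : IsBergman u) (hv : IsBergman v) :
    bergmanNorm (u - v) ≤ bergmanNorm u + bergmanNorm v := by
  rw [sub_eq_add_neg, ← bergmanNorm_neg v]
  exact bergmanNorm_add_le hu hv.neg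

lemma discExt_zero : discExt 0 = 0 := by
  ext z
  simp [discExt]

lemma isBergman_zero : IsBergman 0 :=
  ⟨isAnalyticOnDisc_const 0, by rw [discExt_zero]; exact MemLp.zero⟩

lemma bergmanNorm_zero : bergmanNorm 0 = 0 := by
  rw [bergmanNorm, discExt_zero]
  simp

lemma isBergman_sum {ι : Type*} {u : ι → 𝔻 → ℂ} {s : Finset ι} (hu : ∀ i ∈ s, IsBergman (u i)) :
    IsBergman (∑ i ∈ s, u i) :=
  Finset.sum_induction u IsBergman (fun _ _ => IsBergman.add) isBergman_zero hu

lemma bergmanNorm_sum_le {ι : Type*} {u : ι → 𝔻 → ℂ} {s : Finset ι}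
    (hu : ∀ i ∈ s, IsBergman (u i)) :
    bergmanNorm (∑ i ∈ s, u i) ≤ ∑ i ∈ s, bergmanNorm (u i) :=
  Finset.le_sum_of_subadditive_on_pred bergmanNorm IsBergman bergmanNorm_zero.le
    (fun _ _ => bergmanNorm_add_le) (fun _ _ => IsBergman.add) u hu

/-- Pointwise domination passes to the Bergman norm; the additive constant is allowed because
the disc has total mass `1`. -/
lemma isBergman_and_bergmanNorm_le {u v : 𝔻 → ℂ} (hu : IsAnalyticOnDisc u) (hv : IsBergman v)
    {A C : ℝ} (hA : 0 ≤ A) (hC : 0 ≤ C) (huv : ∀ z, ‖u z‖ ≤ A * ‖v z‖ + C) :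
    IsBergman u ∧ bergmanNorm u ≤ A * bergmanNorm v + C := by
  have h1 : ∀ᵐ z ∂discArea, ‖discExt u z‖ ≤ A * ‖discExt v z‖ + C :=
    ae_discArea_of_ball (forall_mem_ball fun z => by simpa only [discExt_coe] using huv z)
  have hv1 : MemLp (fun z => A * ‖discExt v z‖) 2 discArea := hv.2.norm.const_mul A
  have hv2 : MemLp (fun _ : ℂ => C) 2 discArea := memLp_const C
  have hsum : MemLp (fun z => A * ‖discExt v z‖ + C) 2 discArea := hv1.add hv2
  have hle : eLpNorm (discExt u) 2 discArea ≤
      eLpNorm (fun z => A * ‖discExt v z‖) 2 discArea + eLpNorm (fun _ : ℂ => C) 2 discArea := by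
    refine (eLpNorm_mono_ae_real h1).trans ?_
    exact eLpNorm_add_le hv1.1 hv2.1 (by norm_num)
  have e1 : eLpNorm (fun z => A * ‖discExt v z‖) 2 discArea
      = ENNReal.ofReal A * eLpNorm (discExt v) 2 discArea := by
    have := eLpNorm_const_smul A (fun z => ‖discExt v z‖) 2 discArea
    rw [eLpNorm_norm] at this
    rw [← Real.enorm_of_nonneg hA, ← this]
    rfl
  have e2 : eLpNorm (fun _ : ℂ => C) 2 discArea = ENNReal.ofReal C := by
    rw [eLpNorm_const _ (by norm_num) (IsProbabilityMeasure.ne_zero _)]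
    simp [Real.enorm_of_nonneg hC]
  refine ⟨⟨hu, hsum.mono' hu.aestronglyMeasurable h1⟩, ?_⟩
  rw [e1, e2] at hle
  have hfin : ENNReal.ofReal A * eLpNorm (discExt v) 2 discArea ≠ ⊤ :=
    ENNReal.mul_ne_top ENNReal.ofReal_ne_top hv.2.eLpNorm_ne_top
  have := ENNReal.toReal_mono (ENNReal.add_ne_top.2 ⟨hfin, ENNReal.ofReal_ne_top⟩) hle
  rwa [ENNReal.toReal_add hfin ENNReal.ofReal_ne_top, ENNReal.toReal_mul, ENNReal.toReal_ofReal hA,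
    ENNReal.toReal_ofReal hC] at this

lemma isBergman_and_bergmanNorm_le_mul {k v : 𝔻 → ℂ} (hk : IsAnalyticOnDisc k) (hv : IsBergman v)
    {A : ℝ} (hA : 0 ≤ A) (hkA : ∀ z, ‖k z‖ ≤ A) :
    IsBergman (k * v) ∧ bergmanNorm (k * v) ≤ A * bergmanNorm v := by
  simpa using isBergman_and_bergmanNorm_le (hk.mul hv.1) hv hA le_rfl fun z => by
    simpa using mul_le_mul_of_nonneg_right (hkA z) (norm_nonneg (v z))

lemma isBergman_and_bergmanNorm_le_of_bounded {u : 𝔻 → ℂ} (hu : IsAnalyticOnDisc u)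
    {C : ℝ} (hC : 0 ≤ C) (huC : ∀ z, ‖u z‖ ≤ C) : IsBergman u ∧ bergmanNorm u ≤ C := by
  simpa [bergmanNorm_zero] using
    isBergman_and_bergmanNorm_le hu isBergman_zero le_rfl hC (A := 0) fun z => by
      simpa using huC z

/-! ### Conformal invariance -/

/-- The Jacobian of an analytic map is the squared modulus of its derivative. -/
lemma lintegral_image_ball {ψ : ℂ → ℂ} (hψ : DifferentiableOn ℂ ψ (Metric.ball 0 1))
    (hinj : Set.InjOn ψ (Metric.ball 0 1)) (F : ℂ → ENNReal) :
    ∫⁻ w in ψ '' Metric.ball 0 1, F w = ∫⁻ z in Metric.ball 0 1, ‖deriv ψ z‖ₑ ^ 2 * F (ψ z) := by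
  have hd : ∀ z ∈ Metric.ball (0 : ℂ) 1, HasFDerivWithinAt ψ
      ((ContinuousLinearMap.toSpanSingleton ℂ (deriv ψ z)).restrictScalars ℝ)
        (Metric.ball 0 1) z := by
    intro z hz
    exact ((hψ.differentiableAt
      (Metric.isOpen_ball.mem_nhds hz)).hasDerivAt.hasFDerivAt.restrictScalars ℝ).hasFDerivWithinAt
  rw [lintegral_image_eq_lintegral_abs_det_fderiv_mul volume Metric.isOpen_ball.measurableSet hd
    hinj]
  refine lintegral_congr fun z => ?_
  congr 1
  have : ((ContinuousLinearMap.toSpanSingleton ℂ (deriv ψ z)).restrictScalars ℝ).det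
      = ‖deriv ψ z‖ ^ 2 := by
    simp [ContinuousLinearMap.det, LinearMap.det_restrictScalars, Complex.normSq_eq_norm_sq,
      Algebra.norm_complex_eq]
  rw [this, abs_of_nonneg (by positivity), ← ofReal_norm, ENNReal.ofReal_pow (norm_nonneg _)]

/-- The weighted composition `u ↦ (u ∘ φ) φ'` with a disc automorphism `φ` is isometric. -/
lemma isBergman_and_bergmanNorm_comp {u : 𝔻 → ℂ} (hu : IsBergman u) (φ : 𝔻 ≃ 𝔻)
    (hφ : IsAnalyticOnDisc (coeMap φ)) :
    IsBergman ((u ∘ φ) * dDeriv (coeMap φ)) ∧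
      bergmanNorm ((u ∘ φ) * dDeriv (coeMap φ)) = bergmanNorm u := by
  have hinj : Set.InjOn (discExt (coeMap φ)) (Metric.ball 0 1) := by
    refine forall_mem_ball fun z => forall_mem_ball fun w hzw => ?_
    simp only [discExt_coe, coeMap] at hzw
    rw [φ.injective (UnitDisc.coe_injective hzw)]
  have himg : discExt (coeMap φ) '' Metric.ball 0 1 = Metric.ball 0 1 := by
    apply Set.Subset.antisymm
    · rintro _ ⟨z, hz, rfl⟩
      revert z
      refine forall_mem_ball fun z => ?_
      rw [discExt_coe]
      exact coe_mem_ball _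
    · refine forall_mem_ball fun w => ⟨φ.symm w, coe_mem_ball _, ?_⟩
      rw [discExt_coe]
      simp [coeMap]
  have han : IsAnalyticOnDisc ((u ∘ φ) * dDeriv (coeMap φ)) := (hu.1.comp hφ).mul hφ.dDeriv
  have hnorm : eLpNorm (discExt ((u ∘ φ) * dDeriv (coeMap φ))) 2 discArea
      = eLpNorm (discExt u) 2 discArea := by
    rw [eLpNorm_eq_lintegral_rpow_enorm_toReal (by norm_num) (by norm_num),
      eLpNorm_eq_lintegral_rpow_enorm_toReal (by norm_num) (by norm_num), lintegral_discArea,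
      lintegral_discArea]
    congr 2
    conv_rhs => rw [← himg]
    rw [lintegral_image_ball hφ hinj]
    refine setLIntegral_congr_fun Metric.isOpen_ball.measurableSet (forall_mem_ball fun z => ?_)
    simp only [discExt_coe, Pi.mul_apply, Function.comp_apply, enorm_mul, ENNReal.toReal_ofNat]
    rw [ENNReal.mul_rpow_of_nonneg _ _ (by norm_num), mul_comm]
    have : discExt u (coeMap φ z) = u (φ z) := discExt_coe u (φ z)
    rw [this]
    congr 1
    rw [← ENNReal.rpow_natCast]
    rfl
  refine ⟨⟨han, han.aestronglyMeasurable, ?_⟩, ?_⟩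
  · rw [hnorm]
    exact hu.2.eLpNorm_lt_top
  · rw [bergmanNorm, hnorm, bergmanNorm]

/-! ### Point evaluations and completeness -/

/-- The mean value property over circles of radius `r < R`, for the arc `(-π, π)` that occurs in
polar coordinates. -/
lemma enorm_mul_le_lintegral_circle {v : ℂ → ℂ} {z : ℂ} {r R : ℝ} (hr : 0 < r) (hrR : r < R)
    (hv : DifferentiableOn ℂ v (Metric.ball z R)) :
    ENNReal.ofReal (2 * Real.pi) * ‖v z‖ₑ ≤
      ∫⁻ θ in Set.Ioo (-Real.pi) Real.pi, ‖v (circleMap z r θ)‖ₑ := by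
  have hcl : DiffContOnCl ℂ v (Metric.ball z |r|) := by
    rw [abs_of_pos hr]
    refine DifferentiableOn.diffContOnCl (hv.mono ?_)
    rw [closure_ball z hr.ne']
    exact Metric.closedBall_subset_ball hrR
  have h1 := hcl.circleAverage
  rw [Real.circleAverage_eq_integral_add (-Real.pi),
    intervalIntegral.integral_comp_add_right (fun θ => v (circleMap z r θ)),
    zero_add, show 2 * Real.pi + -Real.pi = Real.pi by ring,
    intervalIntegral.integral_of_le (by linarith [Real.pi_pos]),
    integral_Ioc_eq_integral_Ioo] at h1
  have h2 : (2 * Real.pi) • v z = ∫ θ in Set.Ioo (-Real.pi) Real.pi, v (circleMap z r θ) := by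
    rw [← h1, smul_smul, mul_inv_cancel₀ (by positivity), one_smul]
  have h3 : ENNReal.ofReal (2 * Real.pi) * ‖v z‖ₑ = ‖(2 * Real.pi) • v z‖ₑ := by
    rw [enorm_smul, Real.enorm_of_nonneg (by positivity)]
  rw [h3, h2]
  exact enorm_integral_le_lintegral_enorm _

lemma enorm_mul_le_lintegral_ball {v : ℂ → ℂ} {z : ℂ} {R : ℝ} (hR : 0 < R)
    (hv : DifferentiableOn ℂ v (Metric.ball z R)) (hm : Measurable v) :
    ENNReal.ofReal (Real.pi * R ^ 2) * ‖v z‖ₑ ≤ ∫⁻ w in Metric.ball z R, ‖v w‖ₑ := by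
  set F : ℂ → ENNReal := (Metric.ball z R).indicator fun w => ‖v w‖ₑ with hF
  have hFm : Measurable F := hm.enorm.indicator Metric.isOpen_ball.measurableSet
  have hpolar : Measurable fun p : ℝ × ℝ => z + Complex.polarCoord.symm p := by
    simp only [Complex.polarCoord_symm_apply]
    fun_prop
  have hradius : ∫⁻ r in Set.Ioo 0 R, ENNReal.ofReal r = ENNReal.ofReal (R ^ 2 / 2) := by
    rw [← ofReal_integral_eq_lintegral_ofReal, ← integral_Ioc_eq_integral_Ioo,
      ← intervalIntegral.integral_of_le hR.le, integral_id]
    · congr 1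
      ring
    · exact (continuous_id.integrableOn_Icc (a := 0) (b := R)).mono_set Set.Ioo_subset_Icc_self
    · exact (ae_restrict_of_forall_mem measurableSet_Ioo fun r hr => hr.1.le)
  calc ENNReal.ofReal (Real.pi * R ^ 2) * ‖v z‖ₑ
      = ∫⁻ r in Set.Ioo 0 R, ENNReal.ofReal r * (ENNReal.ofReal (2 * Real.pi) * ‖v z‖ₑ) := by
        rw [lintegral_mul_const _ ENNReal.measurable_ofReal, hradius, ← mul_assoc,
          ← ENNReal.ofReal_mul (by positivity)]
        congr 2
        ring
    _ ≤ ∫⁻ r in Set.Ioo 0 R, ∫⁻ θ in Set.Ioo (-Real.pi) Real.pi,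
          ENNReal.ofReal r * F (z + Complex.polarCoord.symm (r, θ)) := by
        refine setLIntegral_mono' measurableSet_Ioo fun r hr => ?_
        rw [lintegral_const_mul _ (by exact hFm.comp (hpolar.comp measurable_prodMk_left))]
        gcongr
        refine (enorm_mul_le_lintegral_circle hr.1 hr.2 hv).trans
          (lintegral_mono fun θ => ?_)
        have hθ : z + Complex.polarCoord.symm (r, θ) = circleMap z r θ := by
          rw [Complex.polarCoord_symm_apply, circleMap, Complex.exp_mul_I]
          simp
        have hmem : circleMap z r θ ∈ Metric.ball z R := by
          simpa [circleMap, abs_of_pos hr.1] using hr.2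
        simp only
        rw [hθ, hF, Set.indicator_of_mem hmem]
    _ = ∫⁻ p in Set.Ioo 0 R ×ˢ Set.Ioo (-Real.pi) Real.pi,
          ENNReal.ofReal p.1 * F (z + Complex.polarCoord.symm p) := by
        rw [Measure.volume_eq_prod, setLIntegral_prod]
        exact ((ENNReal.measurable_ofReal.comp measurable_fst).mul
          (hFm.comp hpolar)).aemeasurable
    _ ≤ ∫⁻ p in polarCoord.target,
          ENNReal.ofReal p.1 • F (z + Complex.polarCoord.symm p) := by
        refine lintegral_mono_set ?_
        rw [polarCoord_target]
        exact Set.prod_mono (fun r hr => hr.1) subset_rfl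
    _ = ∫⁻ w in Metric.ball z R, ‖v w‖ₑ := by
        rw [Complex.lintegral_comp_polarCoord_symm (fun w => F (z + w)),
          lintegral_add_left_eq_self F z, hF, lintegral_indicator Metric.isOpen_ball.measurableSet]

lemma IsAnalyticOnDisc.measurable {u : 𝔻 → ℂ} (hu : IsAnalyticOnDisc u) :
    Measurable (discExt u) := by
  classical
  have h1 : discExt u = (Metric.ball (0 : ℂ) 1).piecewise (discExt u) 0 := by
    ext z
    by_cases hz : z ∈ Metric.ball (0 : ℂ) 1
    · simp [hz]
    · rw [Set.piecewise_eq_of_notMem _ _ _ hz]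
      simp only [Metric.mem_ball, dist_zero_right] at hz
      simp [discExt, hz]
  rw [h1]
  exact ContinuousOn.measurable_piecewise (DifferentiableOn.continuousOn hu) continuousOn_const
    Metric.isOpen_ball.measurableSet

lemma IsBergman.ofReal_bergmanNorm_sq {u : 𝔻 → ℂ} (hu : IsBergman u) :
    ENNReal.ofReal (bergmanNorm u ^ 2) = ∫⁻ z, ‖discExt u z‖ₑ ^ 2 ∂discArea := by
  rw [bergmanNorm, ENNReal.ofReal_pow ENNReal.toReal_nonneg,
    ENNReal.ofReal_toReal hu.2.eLpNorm_ne_top,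
    eLpNorm_eq_lintegral_rpow_enorm_toReal (by norm_num) (by norm_num), ← ENNReal.rpow_natCast,
    ← ENNReal.rpow_mul]
  simp

/-- Point evaluations are bounded on the Bergman space. -/
lemma IsBergman.norm_apply_le {u : 𝔻 → ℂ} (hu : IsBergman u) (z : 𝔻) :
    ‖u z‖ ≤ bergmanNorm u / (1 - ‖(z : ℂ)‖) := by
  have hR : 0 < 1 - ‖(z : ℂ)‖ := by linarith [z.norm_lt_one]
  set R := 1 - ‖(z : ℂ)‖ with hRdef
  have hsub : Metric.ball (z : ℂ) R ⊆ Metric.ball 0 1 := by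
    refine Metric.ball_subset_ball' ?_
    rw [dist_zero_right]
    linarith
  have h1 := enorm_mul_le_lintegral_ball (v := fun w => discExt u w ^ 2) hR
    ((DifferentiableOn.pow hu.1 2).mono hsub) (hu.1.measurable.pow_const 2)
  have h2 : ∫⁻ w in Metric.ball (z : ℂ) R, ‖discExt u w ^ 2‖ₑ ≤
      ENNReal.ofReal Real.pi * ENNReal.ofReal (bergmanNorm u ^ 2) := by
    rw [hu.ofReal_bergmanNorm_sq, lintegral_discArea, ← mul_assoc,
      ENNReal.mul_inv_cancel (by simpa using Real.pi_pos) ENNReal.ofReal_ne_top, one_mul]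
    simp only [enorm_pow]
    exact lintegral_mono_set hsub
  have h3 := h1.trans h2
  rw [discExt_coe, ← ofReal_norm, ← ENNReal.ofReal_mul (by positivity),
    ← ENNReal.ofReal_mul (by positivity), ENNReal.ofReal_le_ofReal_iff (by positivity),
    mul_assoc, mul_le_mul_iff_right₀ Real.pi_pos, norm_pow, ← mul_pow] at h3
  rw [le_div_iff₀ hR, mul_comm]
  exact le_of_sq_le_sq h3 (bergmanNorm_nonneg u)

/-- Fatou's lemma for the Bergman norm. -/
lemma isBergman_of_tendsto {u : ℕ → 𝔻 → ℂ} {v : 𝔻 → ℂ} (hu : ∀ n, IsBergman (u n))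
    (hv : IsAnalyticOnDisc v) (hlim : ∀ z, Tendsto (fun n => u n z) atTop (𝓝 (v z)))
    {B : ℝ} (hB : 0 ≤ B) (huB : ∀ᶠ n in atTop, bergmanNorm (u n) ≤ B) :
    IsBergman v ∧ bergmanNorm v ≤ B := by
  have h1 : eLpNorm (discExt v) 2 discArea ≤ ENNReal.ofReal B := by
    refine (Lp.eLpNorm_lim_le_liminf_eLpNorm (fun n => (hu n).2.1) (discExt v)
      (ae_discArea_of_ball (forall_mem_ball fun z => ?_))).trans ?_
    · simpa only [discExt_coe] using hlim z
    · refine liminf_le_of_frequently_le' (Eventually.frequently ?_)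
      filter_upwards [huB] with n hn
      rw [← ENNReal.ofReal_toReal (hu n).2.eLpNorm_ne_top]
      exact ENNReal.ofReal_le_ofReal hn
  refine ⟨⟨hv, hv.aestronglyMeasurable, h1.trans_lt ENNReal.ofReal_lt_top⟩, ?_⟩
  have := ENNReal.toReal_mono ENNReal.ofReal_ne_top h1
  rwa [ENNReal.toReal_ofReal hB] at this

namespace DirichletSpace

lemma isAnalytic (f : DirichletSpace) : IsAnalyticOnDisc f := f.isDirichlet.1

lemma isBergman_dDeriv (f : DirichletSpace) : IsBergman (dDeriv f) :=
  (isDirichlet_iff.1 f.isDirichlet).2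

lemma norm_sq_eq_bergmanNorm (f : DirichletSpace) :
    ‖f‖ ^ 2 = ‖f 0‖ ^ 2 + bergmanNorm (dDeriv f) ^ 2 := by
  rw [norm_sq_eq]
  congr 1
  have h1 := f.isBergman_dDeriv.ofReal_bergmanNorm_sq
  have hmeas : AEStronglyMeasurable (fun z => ‖discExt (dDeriv f) z‖) discArea :=
    f.isBergman_dDeriv.2.1.norm
  rw [integral_congr_ae (g := fun z => ‖discExt (dDeriv f) z‖ ^ 2)
    ((discDeriv_ae_eq f).mono fun z hz => by simp only [hz]),
    integral_eq_lintegral_of_nonneg_ae (Eventually.of_forall fun z => by positivity)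
      (by simp only [sq]; exact hmeas.mul hmeas),
    ← ENNReal.toReal_ofReal (sq_nonneg (bergmanNorm (dDeriv f))), h1]
  congr 1
  refine lintegral_congr fun z => ?_
  rw [ENNReal.ofReal_pow (norm_nonneg _), ofReal_norm]

lemma bergmanNorm_dDeriv_le (f : DirichletSpace) : bergmanNorm (dDeriv f) ≤ ‖f‖ := by
  refine le_of_sq_le_sq ?_ (norm_nonneg f)
  rw [norm_sq_eq_bergmanNorm]
  nlinarith [sq_nonneg ‖f 0‖]

lemma norm_apply_zero_le (f : DirichletSpace) : ‖f 0‖ ≤ ‖f‖ := by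
  refine le_of_sq_le_sq ?_ (norm_nonneg f)
  rw [norm_sq_eq_bergmanNorm]
  nlinarith [sq_nonneg (bergmanNorm (dDeriv f))]

lemma norm_le_add (f : DirichletSpace) : ‖f‖ ≤ ‖f 0‖ + bergmanNorm (dDeriv f) := by
  have h2 := bergmanNorm_nonneg (dDeriv f)
  refine le_of_sq_le_sq ?_ (by positivity)
  rw [norm_sq_eq_bergmanNorm]
  nlinarith [norm_nonneg (f 0), mul_nonneg (norm_nonneg (f 0)) h2]

/-- An element of the Dirichlet space from its two defining properties. -/
def ofBergman (f : 𝔻 → ℂ) (hf : IsAnalyticOnDisc f) (hf' : IsBergman (dDeriv f)) :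
    DirichletSpace :=
  ⟨f, isDirichlet_iff.2 ⟨hf, hf'⟩⟩

lemma coe_ofBergman (f : 𝔻 → ℂ) (hf : IsAnalyticOnDisc f) (hf' : IsBergman (dDeriv f)) :
    (ofBergman f hf hf' : 𝔻 → ℂ) = f := rfl

lemma coe_sub (f g : DirichletSpace) : ((f - g : DirichletSpace) : 𝔻 → ℂ) = f - g := rfl

/-- The oscillation of an analytic function between `0` and `z` is controlled by the area
integral of its derivative. -/
lemma norm_apply_sub_apply_zero_le (f : DirichletSpace) (z : 𝔻) :
    ‖f z - f 0‖ ≤ bergmanNorm (dDeriv f) / (1 - ‖(z : ℂ)‖) := by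
  have hR : 0 < 1 - ‖(z : ℂ)‖ := by linarith [z.norm_lt_one]
  have hsub : Metric.closedBall (0 : ℂ) ‖(z : ℂ)‖ ⊆ Metric.ball 0 1 :=
    Metric.closedBall_subset_ball z.norm_lt_one
  have hB := bergmanNorm_nonneg (dDeriv f)
  have h1 := Convex.norm_image_sub_le_of_norm_deriv_le (𝕜 := ℂ) (f := discExt f)
    (s := Metric.closedBall (0 : ℂ) ‖(z : ℂ)‖) (x := 0) (y := z)
    (C := bergmanNorm (dDeriv f) / (1 - ‖(z : ℂ)‖))
    (fun x hx => f.isAnalytic.differentiableAt (hsub hx)) (fun x hx => ?_)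
    (convex_closedBall _ _) (Metric.mem_closedBall_self (norm_nonneg _)) (by simp)
  · have h0 : discExt f 0 = f 0 := by
      have := discExt_coe f 0
      rwa [UnitDisc.coe_zero] at this
    rw [discExt_coe, h0, sub_zero] at h1
    refine h1.trans (mul_le_of_le_one_right (by positivity) z.norm_lt_one.le)
  · obtain ⟨y, rfl⟩ : ∃ y : 𝔻, (y : ℂ) = x :=
      ⟨UnitDisc.mk x (by simpa using hsub hx), rfl⟩
    refine (f.isBergman_dDeriv.norm_apply_le y).trans ?_
    have : ‖(y : ℂ)‖ ≤ ‖(z : ℂ)‖ := by simpa using hx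
    gcongr

lemma norm_apply_le (f : DirichletSpace) (z : 𝔻) :
    ‖f z‖ ≤ (1 + 1 / (1 - ‖(z : ℂ)‖)) * ‖f‖ := by
  have hR : 0 < 1 - ‖(z : ℂ)‖ := by linarith [z.norm_lt_one]
  calc ‖f z‖ = ‖f 0 + (f z - f 0)‖ := by congr 1; ring
    _ ≤ ‖f 0‖ + ‖f z - f 0‖ := norm_add_le _ _
    _ ≤ ‖f‖ + ‖f‖ / (1 - ‖(z : ℂ)‖) := by
        refine add_le_add f.norm_apply_zero_le ((f.norm_apply_sub_apply_zero_le z).trans ?_)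
        gcongr
        exact f.bergmanNorm_dDeriv_le
    _ = _ := by ring

/-- A Cauchy sequence of the Dirichlet space converges locally uniformly, together with its
derivatives, and Fatou's lemma identifies the limit. -/
instance : CompleteSpace DirichletSpace := by
  refine Metric.complete_of_cauchySeq_tendsto fun f hf => ?_
  have hpt : ∀ z, CauchySeq fun n => f n z := by
    intro z
    have hR : 0 < 1 - ‖(z : ℂ)‖ := by linarith [z.norm_lt_one]
    rw [Metric.cauchySeq_iff] at hf ⊢
    intro ε hε
    obtain ⟨N, hN⟩ := hf (ε / (1 + 1 / (1 - ‖(z : ℂ)‖))) (by positivity)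
    refine ⟨N, fun m hm n hn => ?_⟩
    have h1 := hN m hm n hn
    rw [lt_div_iff₀ (by positivity)] at h1
    rw [dist_eq_norm] at h1 ⊢
    have h2 := norm_apply_le (f m - f n) z
    rw [coe_sub, Pi.sub_apply] at h2
    linarith
  choose F hF using fun z => cauchySeq_tendsto_of_complete (hpt z)
  have hloc : TendstoLocallyUniformlyOn (fun n => discExt (f n)) (discExt F) atTop
      (Metric.ball 0 1) := by
    refine tendstoLocallyUniformlyOn_of_forall_exists_nhds (forall_mem_ball fun x => ?_)
    obtain ⟨r, hxr, hr⟩ := exists_between x.norm_lt_one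
    have hsub : Metric.ball (0 : ℂ) r ⊆ Metric.ball 0 1 := Metric.ball_subset_ball hr.le
    refine ⟨Metric.ball 0 r, mem_nhdsWithin_of_mem_nhds
      (Metric.isOpen_ball.mem_nhds (by simpa using hxr)), ?_⟩
    have hR : 0 < 1 - r := by linarith
    refine UniformCauchySeqOn.tendstoUniformlyOn_of_tendsto ?_ fun y hy => ?_
    · rw [Metric.uniformCauchySeqOn_iff]
      intro ε hε
      obtain ⟨N, hN⟩ := Metric.cauchySeq_iff.1 hf (ε / (1 + 1 / (1 - r))) (by positivity)
      refine ⟨N, fun m hm n hn y hy => ?_⟩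
      obtain ⟨y, rfl⟩ : ∃ w : 𝔻, (w : ℂ) = y := ⟨UnitDisc.mk y (by simpa using hsub hy), rfl⟩
      have h1 := hN m hm n hn
      rw [lt_div_iff₀ (by positivity)] at h1
      rw [dist_eq_norm] at h1 ⊢
      have h2 := norm_apply_le (f m - f n) y
      rw [coe_sub, Pi.sub_apply] at h2
      have hy' : ‖(y : ℂ)‖ ≤ r := by simpa using (Metric.mem_ball.1 hy).le
      have h3 : (1 + 1 / (1 - ‖(y : ℂ)‖)) * ‖f m - f n‖ ≤ (1 + 1 / (1 - r)) * ‖f m - f n‖ := by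
        gcongr
      rw [discExt_coe, discExt_coe]
      linarith
    · obtain ⟨y, rfl⟩ : ∃ w : 𝔻, (w : ℂ) = y := ⟨UnitDisc.mk y (by simpa using hsub hy), rfl⟩
      simpa only [discExt_coe] using hF y
  have hev : ∀ᶠ n in atTop, DifferentiableOn ℂ (discExt (f n)) (Metric.ball 0 1) :=
    Eventually.of_forall fun n => (f n).isAnalytic
  have hFan : IsAnalyticOnDisc F := hloc.differentiableOn hev Metric.isOpen_ball
  have hderiv : ∀ z : 𝔻, Tendsto (fun n => dDeriv (f n) z) atTop (𝓝 (dDeriv F z)) := fun z =>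
    (hloc.deriv hev Metric.isOpen_ball).tendsto_at (coe_mem_ball z)
  -- Fatou, applied to `f m - f n` as `m → ∞`
  have hclose : ∀ ε > 0, ∃ N, ∀ n ≥ N, IsBergman (dDeriv F - dDeriv (f n)) ∧
      bergmanNorm (dDeriv F - dDeriv (f n)) ≤ ε := by
    intro ε hε
    obtain ⟨N, hN⟩ := Metric.cauchySeq_iff.1 hf ε hε
    refine ⟨N, fun n hn => isBergman_of_tendsto (u := fun m => dDeriv (f m) - dDeriv (f n))
      (fun m => (f m).isBergman_dDeriv.sub (f n).isBergman_dDeriv)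
      (hFan.dDeriv.sub (f n).isAnalytic.dDeriv)
      (fun z => (hderiv z).sub_const _) hε.le ?_⟩
    filter_upwards [eventually_ge_atTop N] with m hm
    rw [← dDeriv_sub (f m).isAnalytic (f n).isAnalytic, ← coe_sub]
    refine (bergmanNorm_dDeriv_le _).trans ?_
    rw [← dist_eq_norm]
    exact (hN m hm n hn).le
  have hFB : IsBergman (dDeriv F) := by
    obtain ⟨N, hN⟩ := hclose 1 one_pos
    simpa using (hN N le_rfl).1.add (f N).isBergman_dDeriv
  refine ⟨ofBergman F hFan hFB, ?_⟩
  rw [Metric.tendsto_atTop]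
  intro ε hε
  obtain ⟨N, hN⟩ := hclose (ε / 3) (by positivity)
  obtain ⟨N', hN'⟩ := Metric.tendsto_atTop.1 (hF 0) (ε / 3) (by positivity)
  refine ⟨max N N', fun n hn => ?_⟩
  have h1 := (hN n ((le_max_left _ _).trans hn)).2
  have h2 := hN' n ((le_max_right _ _).trans hn)
  rw [dist_comm, dist_eq_norm] at h2 ⊢
  have h3 := norm_le_add (ofBergman F hFan hFB - f n)
  rw [coe_sub, coe_ofBergman, Pi.sub_apply, dDeriv_sub hFan (f n).isAnalytic] at h3
  linarith

end DirichletSpace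

/-! ### The half-plane model and parabolic automorphisms -/

/-- The Cayley transform of the disc onto the right half-plane, sending the boundary point `a`
to infinity. -/
def cayley (a z : ℂ) : ℂ := (a + z) / (a - z)

/-- The inverse of the Cayley transform `cayley a`. -/
def cayleyInv (a w : ℂ) : ℂ := a * (w - 1) / (w + 1)

section Cayley

variable {a : ℂ}

lemma sub_coe_ne_zero (ha : ‖a‖ = 1) (z : 𝔻) : a - z ≠ 0 := by
  intro h
  have h1 := z.norm_lt_one
  rw [← sub_eq_zero.1 h, ha] at h1
  exact lt_irrefl _ h1

lemma ne_zero_of_norm_eq_one (ha : ‖a‖ = 1) : a ≠ 0 := by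
  rintro rfl
  simp at ha

lemma cayley_add_one (ha : ‖a‖ = 1) (z : 𝔻) : cayley a z + 1 = 2 * a / (a - z) := by
  have := sub_coe_ne_zero ha z
  rw [cayley]
  field_simp
  ring

lemma cayley_re_pos (ha : ‖a‖ = 1) (z : 𝔻) : 0 < (cayley a z).re := by
  have h0 := sub_coe_ne_zero ha z
  have h1 : 0 < normSq (a - z) := normSq_pos.2 h0
  have h2 : normSq a = 1 := by rw [normSq_eq_norm_sq, ha]; norm_num
  have h3 := z.normSq_lt_one
  rw [cayley, div_re, ← add_div]
  apply div_pos _ h1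
  simp only [normSq_apply, add_re, add_im, sub_re, sub_im] at *
  nlinarith

lemma add_one_ne_zero_of_re_pos {w : ℂ} (hw : 0 < w.re) : w + 1 ≠ 0 := by
  intro h
  have := congrArg Complex.re h
  simp at this
  linarith

lemma norm_cayleyInv_lt_one (ha : ‖a‖ = 1) {w : ℂ} (hw : 0 < w.re) : ‖cayleyInv a w‖ < 1 := by
  have h1 : 0 < ‖w + 1‖ := norm_pos_iff.2 (add_one_ne_zero_of_re_pos hw)
  rw [cayleyInv, norm_div, norm_mul, ha, one_mul, div_lt_one h1]
  refine lt_of_pow_lt_pow_left₀ 2 h1.le ?_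
  rw [← normSq_eq_norm_sq, ← normSq_eq_norm_sq]
  simp only [normSq_apply, add_re, add_im, sub_re, sub_im, one_re, one_im]
  nlinarith

lemma cayleyInv_cayley (ha : ‖a‖ = 1) (z : 𝔻) : cayleyInv a (cayley a z) = z := by
  have h0 := sub_coe_ne_zero ha z
  have h1 := ne_zero_of_norm_eq_one ha
  rw [cayleyInv, cayley_add_one ha, cayley]
  field_simp
  ring

lemma cayley_cayleyInv (ha : ‖a‖ = 1) {w : ℂ} (hw : 0 < w.re) : cayley a (cayleyInv a w) = w := by
  have h0 := add_one_ne_zero_of_re_pos hw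
  have h1 := ne_zero_of_norm_eq_one ha
  have h2 : a - cayleyInv a w = 2 * a / (w + 1) := by
    rw [cayleyInv]
    field_simp
    ring
  rw [cayley, h2, cayleyInv]
  field_simp
  ring

lemma hasDerivAt_cayley (ha : ‖a‖ = 1) (z : 𝔻) :
    HasDerivAt (cayley a) (2 * a / (a - z) ^ 2) z := by
  have h0 := sub_coe_ne_zero ha z
  have h1 := ((hasDerivAt_id (z : ℂ)).const_add a).div ((hasDerivAt_id (z : ℂ)).const_sub a) h0
  refine h1.congr_deriv ?_
  simp only [id]
  congr 1
  ring

/-- The Cayley transform as a bijection of the disc onto the right half-plane. -/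
def cayleyEquiv (a : ℂ) (ha : ‖a‖ = 1) : 𝔻 ≃ {w : ℂ // 0 < w.re} where
  toFun z := ⟨cayley a z, cayley_re_pos ha z⟩
  invFun w := UnitDisc.mk (cayleyInv a w) (norm_cayleyInv_lt_one ha w.2)
  left_inv z := UnitDisc.coe_injective (cayleyInv_cayley ha z)
  right_inv w := Subtype.ext (cayley_cayleyInv ha w.2)

/-- The vertical translation `w ↦ w + b i` of the right half-plane. -/
def verticalShift (b : ℝ) : {w : ℂ // 0 < w.re} ≃ {w : ℂ // 0 < w.re} where
  toFun w := ⟨w + b * I, by simpa using w.2⟩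
  invFun w := ⟨w - b * I, by simpa using w.2⟩
  left_inv w := by simp
  right_inv w := by simp

/-- The parabolic automorphism of the disc that fixes the boundary point `a` and is the
translation by `b i` in the half-plane model. -/
def parabolic (a : ℂ) (ha : ‖a‖ = 1) (b : ℝ) : 𝔻 ≃ 𝔻 :=
  ((cayleyEquiv a ha).trans (verticalShift b)).trans (cayleyEquiv a ha).symm

variable (ha : ‖a‖ = 1)

lemma cayley_injective (ha : ‖a‖ = 1) {z w : 𝔻} (h : cayley a z = cayley a w) : z = w :=
  (cayleyEquiv a ha).injective (Subtype.ext h)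

lemma cayley_parabolic (b : ℝ) (z : 𝔻) : cayley a (parabolic a ha b z) = cayley a z + b * I := by
  have h1 : cayleyEquiv a ha (parabolic a ha b z) = verticalShift b (cayleyEquiv a ha z) := by
    simp [parabolic]
  exact congrArg Subtype.val h1

lemma parabolic_add (b c : ℝ) (z : 𝔻) :
    parabolic a ha (b + c) z = parabolic a ha b (parabolic a ha c z) := by
  apply cayley_injective ha
  simp only [cayley_parabolic]
  push_cast
  ring

lemma parabolic_zero (z : 𝔻) : parabolic a ha 0 z = z := by
  apply cayley_injective ha
  simp [cayley_parabolic]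

lemma parabolic_neg_parabolic (b : ℝ) (z : 𝔻) :
    parabolic a ha (-b) (parabolic a ha b z) = z := by
  rw [← parabolic_add, neg_add_cancel, parabolic_zero]

lemma parabolic_parabolic_neg (b : ℝ) (z : 𝔻) :
    parabolic a ha b (parabolic a ha (-b) z) = z := by
  rw [← parabolic_add, add_neg_cancel, parabolic_zero]

lemma isAnalyticOnDisc_parabolic (b : ℝ) : IsAnalyticOnDisc (coeMap (parabolic a ha b)) := by
  have h1 : ∀ z : 𝔻, coeMap (parabolic a ha b) z = cayleyInv a (cayley a z + b * I) := fun z => by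
    rw [← cayley_parabolic ha, cayleyInv_cayley ha, coeMap]
  refine isAnalyticOnDisc_of_hasDerivAt
    (F := fun z => cayleyInv a (cayley a z + b * I)) h1 fun z => DifferentiableAt.hasDerivAt ?_
  have h2 : DifferentiableAt ℂ (cayley a) z := (hasDerivAt_cayley ha z).differentiableAt
  have h3 : cayley a z + b * I + 1 ≠ 0 :=
    add_one_ne_zero_of_re_pos (by simpa using cayley_re_pos ha z)
  simp only [cayleyInv]
  fun_prop (disch := assumption)

end Cayley

/-- In the half-plane model a parabolic automorphism in the normal form
`e^{iθ} (p - z) / (1 - p̄ z)` is a translation along the boundary: the fixed point equation has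
`a` as a double root. -/
lemma IsParabolicAut.exists_parabolic {φ : 𝔻 → 𝔻} {a : ℂ} (hφ : IsParabolicAut φ a) :
    ∃ (ha : ‖a‖ = 1) (b : ℝ), b ≠ 0 ∧ ∀ z, φ z = parabolic a ha b z := by
  obtain ⟨p, θ, hθ1, hθ2, hφ, hp, ha, hfix⟩ := hφ
  have hE1 : Complex.exp (θ * I) ≠ 0 := Complex.exp_ne_zero _
  -- `4 |p|² e^{iθ} = (1 + e^{iθ})²`, as `|p| = cos (θ / 2)`
  have hdisc : 4 * (conj (p : ℂ) * p) * Complex.exp (θ * I) = (1 + Complex.exp (θ * I)) ^ 2 := by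
    have h1 : conj (p : ℂ) * p = (Complex.cos (θ / 2)) ^ 2 := by
      rw [Complex.conj_mul', hp]
      push_cast
      rfl
    have h2 : Complex.exp (θ * I) = Complex.exp (θ / 2 * I) * Complex.exp (θ / 2 * I) := by
      rw [← Complex.exp_add]
      congr 1
      ring
    have h3 : Complex.exp (-(θ / 2 : ℂ) * I) * Complex.exp (θ / 2 * I) = 1 := by
      rw [← Complex.exp_add]
      simp
    rw [h1, Complex.cos, h2]
    linear_combination (2 * Complex.exp (θ / 2 * I) ^ 2 +
      Complex.exp (-(θ / 2 : ℂ) * I) * Complex.exp (θ / 2 * I) + 1) * h3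
  have hEnorm : ‖Complex.exp (θ * I)‖ = 1 := Complex.norm_exp_ofReal_mul_I θ
  set E := Complex.exp (θ * I) with hE
  set q := conj (p : ℂ) with hq
  have hqnorm : ‖q‖ < 1 := by rw [hq, RCLike.norm_conj]; exact p.norm_lt_one
  have hden : ∀ w : ℂ, ‖w‖ ≤ 1 → 1 - q * w ≠ 0 := by
    intro w hw h
    have h1 : ‖q * w‖ = 1 := by rw [← sub_eq_zero.1 h]; simp
    rw [norm_mul] at h1
    nlinarith [norm_nonneg q, norm_nonneg w]
  have hfa : discAut θ p a = a := (hfix a ha.le).2 rfl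
  have hquad : q * a ^ 2 - (1 + E) * a + E * p = 0 := by
    have h1 := hden a ha.le
    rw [discAut, ← hE, ← hq] at hfa
    rw [mul_div_assoc', div_eq_iff h1] at hfa
    linear_combination hfa
  have hdouble : 2 * (q * a) = 1 + E := by
    have : (2 * (q * a) - (1 + E)) ^ 2 = 0 := by
      linear_combination 4 * q * hquad - hdisc
    exact sub_eq_zero.1 (pow_eq_zero_iff (two_ne_zero)|>.1 this)
  have hsq : E * p = q * a ^ 2 := by linear_combination hquad - a * hdouble
  have ha0 := ne_zero_of_norm_eq_one ha
  have hp0 : q ≠ 0 := by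
    intro h0
    -- if `p = 0` then the map is the identity, which also fixes `0`
    have hE' : E = -1 := by
      rw [h0] at hdouble
      linear_combination -hdouble
    have hp' : (p : ℂ) = 0 := by
      rw [hq] at h0
      simpa using h0
    have h1 : discAut θ p 0 = 0 := by simp [discAut, hp']
    exact ha0 ((hfix 0 (by simp)).1 h1).symm
  have hqa := hden a ha.le
  have hbre : (2 * (q * a) / (1 - q * a)).re = 0 := by
    have hE2 : conj E * E = 1 := by
      rw [Complex.conj_mul', hEnorm]
      norm_num
    have hqa' : q * a = (1 + E) / 2 := by linear_combination hdouble / 2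
    have h1 : (1 : ℂ) - E ≠ 0 := by
      intro h
      apply hqa
      rw [hqa']
      linear_combination h / 2
    have h1' : (1 : ℂ) - conj E ≠ 0 := by
      intro h
      apply h1
      have := congrArg conj h
      simpa using this
    have h2 : conj (2 * (q * a) / (1 - q * a)) = -(2 * (q * a) / (1 - q * a)) := by
      have h3 : 2 * (q * a) / (1 - q * a) = 2 * (1 + E) / (1 - E) := by
        rw [div_eq_div_iff hqa h1, hqa']
        ring
      rw [h3]
      simp only [map_div₀, map_mul, map_add, map_sub, map_one, map_ofNat]
      rw [← neg_div, div_eq_div_iff h1' h1]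
      linear_combination (-4) * hE2
    have h4 := congrArg Complex.re h2
    simp only [conj_re, neg_re] at h4
    linarith
  set β := 2 * (q * a) / (1 - q * a) with hβ
  have hβI : (β.im : ℂ) * I = β := by
    apply Complex.ext <;> simp [hbre]
  refine ⟨ha, β.im, ?_, fun z => ?_⟩
  · intro h0
    have h1 : β = 0 := by rw [← hβI, h0]; simp
    rw [hβ, div_eq_zero_iff] at h1
    rcases h1 with h1 | h1
    · simp [hp0, ha0] at h1
    · exact hqa h1
  · apply cayley_injective ha
    rw [cayley_parabolic, hβI]
    have hz1 := hden z z.norm_lt_one.le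
    have hz2 := sub_coe_ne_zero ha z
    have h1 : a - φ z = (1 - q * a) * (a - z) / (1 - q * z) := by
      rw [hφ, discAut, ← hE, ← hq]
      rw [eq_div_iff hz1, sub_mul, mul_assoc, div_mul_cancel₀ _ hz1]
      linear_combination (-1 : ℂ) * hsq - z * hdouble
    have h2 : cayley a (φ z) + 1 = cayley a z + 1 + β := by
      rw [cayley_add_one ha, cayley_add_one ha, h1, hβ, div_div_eq_mul_div,
        div_add_div _ _ hz2 hqa, div_eq_div_iff (mul_ne_zero hqa hz2) (mul_ne_zero hz2 hqa)]
      ring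
    linear_combination h2

/-! ### Composition with parabolic automorphisms -/

section Composition

variable {a : ℂ} (ha : ‖a‖ = 1)

lemma isBergman_and_bergmanNorm_dDeriv_comp {f : 𝔻 → ℂ} (hf : IsAnalyticOnDisc f)
    (hf' : IsBergman (dDeriv f)) (b : ℝ) :
    IsBergman (dDeriv (f ∘ parabolic a ha b)) ∧
      bergmanNorm (dDeriv (f ∘ parabolic a ha b)) = bergmanNorm (dDeriv f) := by
  rw [dDeriv_comp hf (isAnalyticOnDisc_parabolic ha b)]
  exact isBergman_and_bergmanNorm_comp hf' _ (isAnalyticOnDisc_parabolic ha b)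

/-- Composition of a function of the Dirichlet space with a parabolic automorphism. -/
def DirichletSpace.compParabolic (b : ℝ) (f : DirichletSpace) : DirichletSpace :=
  ofBergman (f ∘ parabolic a ha b) (f.isAnalytic.comp (isAnalyticOnDisc_parabolic ha b))
    (isBergman_and_bergmanNorm_dDeriv_comp ha f.isAnalytic f.isBergman_dDeriv b).1

namespace DirichletSpace

lemma compParabolic_apply (b : ℝ) (f : DirichletSpace) (z : 𝔻) :
    compParabolic ha b f z = f (parabolic a ha b z) := rfl

lemma bergmanNorm_dDeriv_compParabolic (b : ℝ) (f : DirichletSpace) :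
    bergmanNorm (dDeriv (compParabolic ha b f)) = bergmanNorm (dDeriv f) :=
  (isBergman_and_bergmanNorm_dDeriv_comp ha f.isAnalytic f.isBergman_dDeriv b).2

/-- Along the orbit of `0`, each step changes the value of `f` by a bounded amount, since the
seminorm `‖f'‖` is invariant. -/
lemma norm_apply_parabolic_zero_le (b : ℝ) (f : DirichletSpace) (n : ℕ) :
    ‖f (parabolic a ha (n * b) 0)‖ ≤
      ‖f 0‖ + n * (bergmanNorm (dDeriv f) / (1 - ‖(parabolic a ha b 0 : ℂ)‖)) := by
  induction n with
  | zero => simp [parabolic_zero]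
  | succ n ih =>
    have h1 := norm_apply_sub_apply_zero_le (compParabolic ha (n * b) f) (parabolic a ha b 0)
    rw [bergmanNorm_dDeriv_compParabolic, compParabolic_apply, compParabolic_apply,
      ← parabolic_add, show (n : ℝ) * b + b = (n + 1 : ℕ) * b by push_cast; ring] at h1
    have h2 := norm_le_norm_add_norm_sub (f (parabolic a ha (n * b) 0))
      (f (parabolic a ha ((n + 1 : ℕ) * b) 0))
    rw [norm_sub_rev] at h2
    push_cast at *
    linarith

lemma norm_compParabolic_le (b : ℝ) (f : DirichletSpace) (n : ℕ) :
    ‖compParabolic ha (n * b) f‖ ≤ (2 + n / (1 - ‖(parabolic a ha b 0 : ℂ)‖)) * ‖f‖ := by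
  have hR : 0 < 1 - ‖(parabolic a ha b 0 : ℂ)‖ := by
    linarith [(parabolic a ha b 0).norm_lt_one]
  have h1 := norm_le_add (compParabolic ha (n * b) f)
  rw [compParabolic_apply, bergmanNorm_dDeriv_compParabolic] at h1
  have h2 := norm_apply_parabolic_zero_le ha b f n
  have h3 : (n : ℝ) * (bergmanNorm (dDeriv f) / (1 - ‖(parabolic a ha b 0 : ℂ)‖)) ≤
      n * (‖f‖ / (1 - ‖(parabolic a ha b 0 : ℂ)‖)) := by
    gcongr
    exact f.bergmanNorm_dDeriv_le
  have h4 := f.norm_apply_zero_le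
  have h5 := f.bergmanNorm_dDeriv_le
  calc _ ≤ ‖f‖ + n * (‖f‖ / (1 - ‖(parabolic a ha b 0 : ℂ)‖)) + ‖f‖ := by linarith
    _ = _ := by ring

/-- Composition with a parabolic automorphism, as a bounded operator. -/
def compParabolicCLM (b : ℝ) : DirichletSpace →L[ℂ] DirichletSpace :=
  LinearMap.mkContinuous
    { toFun := compParabolic ha b
      map_add' := fun _ _ => rfl
      map_smul' := fun _ _ => rfl }
    (2 + 1 / (1 - ‖(parabolic a ha b 0 : ℂ)‖))
    fun f => by
      change ‖compParabolic ha b f‖ ≤ _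
      simpa using norm_compParabolic_le ha b f 1

lemma compParabolicCLM_apply (b : ℝ) (f : DirichletSpace) :
    compParabolicCLM ha b f = compParabolic ha b f := rfl

end DirichletSpace

end Composition

/-! ### The weight of a bounded weighted composition operator -/

lemma le_of_forall_pow_le {x m C : ℝ} (hm : 0 ≤ m)
    (h : ∀ n : ℕ, x ^ n ≤ C * (n + 1) ^ 2 * m ^ n) : x ≤ m := by
  by_contra! hlt
  have hx : 0 < x := hm.trans_lt hlt
  have hr0 : 0 ≤ m / x := by positivity
  have hr1 : m / x < 1 := (div_lt_one hx).2 hlt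
  have habs : |m / x| < 1 := by rwa [abs_of_nonneg hr0]
  have h1 : Tendsto (fun n : ℕ => C * ((n : ℝ) ^ 2 * (m / x) ^ n + 2 * ((n : ℝ) ^ 1 * (m / x) ^ n)
      + (m / x) ^ n)) atTop (𝓝 (C * (0 + 2 * 0 + 0))) :=
    (((tendsto_pow_const_mul_const_pow_of_abs_lt_one 2 habs).add
      ((tendsto_pow_const_mul_const_pow_of_abs_lt_one 1 habs).const_mul 2)).add
      (tendsto_pow_atTop_nhds_zero_of_abs_lt_one habs)).const_mul C
  have h2 : (1 : ℝ) ≤ C * (0 + 2 * 0 + 0) := by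
    refine ge_of_tendsto' h1 fun n => ?_
    have h3 := h n
    have h4 : C * ((n : ℝ) ^ 2 * (m / x) ^ n + 2 * ((n : ℝ) ^ 1 * (m / x) ^ n) + (m / x) ^ n)
        = C * (n + 1) ^ 2 * m ^ n / x ^ n := by
      rw [div_pow]
      ring
    rw [h4, le_div_iff₀ (by positivity), one_mul]
    exact h3
  norm_num at h2

/-- The filter of points of the disc tending to the boundary point `a`, described in the
half-plane model. -/
def farFilter (a : ℂ) : Filter 𝔻 := comap (fun z : 𝔻 => cayley a z) (Bornology.cobounded ℂ)

section FarFilter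

variable {a : ℂ} (ha : ‖a‖ = 1)

include ha in
lemma farFilter_le : farFilter a ≤ comap (fun z : 𝔻 => (z : ℂ)) (𝓝 a) := by
  rw [← tendsto_iff_comap]
  have h1 : Tendsto (fun z : 𝔻 => cayley a z + 1) (farFilter a) (Bornology.cobounded ℂ) :=
    (tendsto_add_const_cobounded (1 : ℂ)).comp tendsto_comap
  have h2 : Tendsto (fun z : 𝔻 => a - 2 * a * (cayley a z + 1)⁻¹) (farFilter a)
      (𝓝 (a - 2 * a * 0)) :=
    ((tendsto_inv₀_cobounded.comp h1).const_mul (2 * a)).const_sub a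
  simp only [mul_zero, sub_zero] at h2
  refine h2.congr fun z => ?_
  have h3 := sub_coe_ne_zero ha z
  have h4 := ne_zero_of_norm_eq_one ha
  rw [cayley_add_one ha]
  field_simp
  ring

lemma tendsto_parabolic_farFilter (b : ℝ) :
    Tendsto (parabolic a ha b) (farFilter a) (farFilter a) := by
  refine tendsto_comap_iff.2 ?_
  have h1 : Tendsto (fun z : 𝔻 => cayley a z + b * I) (farFilter a) (Bornology.cobounded ℂ) :=
    (tendsto_add_const_cobounded _).comp tendsto_comap
  exact h1.congr fun z => (cayley_parabolic ha b z).symm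

include ha in
lemma farFilter_neBot : (farFilter a).NeBot := by
  have h1 : Tendsto (fun n : ℕ => parabolic a ha n 0) atTop (farFilter a) := by
    refine tendsto_comap_iff.2 ?_
    rw [← tendsto_norm_atTop_iff_cobounded]
    refine tendsto_atTop_mono' _ ?_
      (tendsto_atTop_add_const_right _ (-‖cayley a (0 : 𝔻)‖) tendsto_natCast_atTop_atTop)
    filter_upwards with n
    simp only [Function.comp_apply, cayley_parabolic]
    have h2 := norm_sub_le (cayley a (0 : 𝔻) + (n : ℝ) * I) (cayley a (0 : 𝔻))
    rw [add_sub_cancel_left] at h2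
    simp only [ofReal_natCast, norm_mul, norm_natCast, norm_I, mul_one] at h2 ⊢
    linarith
  exact h1.neBot

lemma exists_forall_norm_le_of_tendsto {k : 𝔻 → ℂ} {c : ℂ} (hc : Tendsto k (farFilter a) (𝓝 c))
    {ε : ℝ} (hε : 0 < ε) :
    ∃ R : ℝ, 0 < R ∧ ∀ z : 𝔻, R ≤ ‖cayley a z‖ → ‖k z - c‖ ≤ ε := by
  have h1 := (Metric.tendsto_nhds.1 hc) ε hε
  rw [farFilter, eventually_comap, ← comap_norm_atTop, eventually_comap] at h1
  obtain ⟨R, hR⟩ := eventually_atTop.1 h1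
  refine ⟨max R 1, by positivity, fun z hz => ?_⟩
  have := hR _ ((le_max_left _ _).trans hz) _ rfl z rfl
  rw [dist_eq_norm] at this
  exact this.le

end FarFilter

namespace DirichletSpace

/-- The constant function `1`. -/
def one : DirichletSpace :=
  ofBergman (fun _ => 1) (isAnalyticOnDisc_const 1) (by rw [dDeriv_const]; exact isBergman_zero)

lemma one_apply (z : 𝔻) : one z = 1 := rfl

end DirichletSpace

open DirichletSpace

namespace IsWeightedComposition

variable {a : ℂ} {ha : ‖a‖ = 1} {b : ℝ} {k : 𝔻 → ℂ} {V : DirichletSpace →L[ℂ] DirichletSpace}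

lemma weight_eq {φ : 𝔻 → 𝔻} (hV : IsWeightedComposition k φ V) : k = V one := by
  funext z
  rw [hV, one_apply, mul_one]

lemma isAnalyticOnDisc_weight {φ : 𝔻 → 𝔻} (hV : IsWeightedComposition k φ V) :
    IsAnalyticOnDisc k := by
  rw [hV.weight_eq]
  exact (V one).isAnalytic

/-- Multiplication by the weight is the weighted composition operator followed by the inverse
composition operator, hence bounded. -/
lemma exists_mul_operator (hV : IsWeightedComposition k (parabolic a ha b) V) :
    ∃ M : DirichletSpace →L[ℂ] DirichletSpace, ∀ f z, M f z = k z * f z := by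
  refine ⟨V ∘L compParabolicCLM ha (-b), fun f z => ?_⟩
  rw [ContinuousLinearMap.comp_apply, hV, compParabolicCLM_apply, compParabolic_apply,
    parabolic_neg_parabolic]

/-- A multiplier is bounded by the norm of the multiplication operator `M`: evaluate `M ^ n 1`. -/
lemma exists_weight_bounds (hV : IsWeightedComposition k (parabolic a ha b) V) :
    ∃ H : ℝ, 0 ≤ H ∧ (∀ z, ‖k z‖ ≤ H) ∧ ∃ B : ℝ, 0 ≤ B ∧ ∀ f : DirichletSpace,
      IsBergman (dDeriv k * f) ∧ bergmanNorm (dDeriv k * f) ≤ B * ‖f‖ := by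
  obtain ⟨M, hM⟩ := hV.exists_mul_operator
  have hbd : ∀ z, ‖k z‖ ≤ ‖M‖ := by
    intro z
    have hR : 0 < 1 - ‖(z : ℂ)‖ := by linarith [z.norm_lt_one]
    have hpow : ∀ n : ℕ, (M ^ n) one z = k z ^ n := by
      intro n
      induction n with
      | zero => rfl
      | succ n ih => rw [pow_succ', ContinuousLinearMap.mul_def, ContinuousLinearMap.comp_apply, hM, ih, pow_succ']
    refine le_of_forall_pow_le (C := (1 + 1 / (1 - ‖(z : ℂ)‖)) * ‖one‖) (norm_nonneg M)
      fun n => ?_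
    have h1 := norm_apply_le ((M ^ n) one) z
    rw [hpow, norm_pow] at h1
    have h2 : ‖(M ^ n) one‖ ≤ ‖M‖ ^ n * ‖one‖ := by
      induction n with
      | zero => simp
      | succ n ih =>
        rw [pow_succ', ContinuousLinearMap.mul_def, ContinuousLinearMap.comp_apply, pow_succ', mul_assoc]
        have h3 := norm_apply_le ((M ^ n) one) z
        rw [hpow, norm_pow] at h3
        exact (M.le_opNorm _).trans (by gcongr; exact ih h3)
    calc ‖k z‖ ^ n ≤ (1 + 1 / (1 - ‖(z : ℂ)‖)) * (‖M‖ ^ n * ‖one‖) := h1.trans (by gcongr)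
      _ = (1 + 1 / (1 - ‖(z : ℂ)‖)) * ‖one‖ * 1 * ‖M‖ ^ n := by ring
      _ ≤ (1 + 1 / (1 - ‖(z : ℂ)‖)) * ‖one‖ * (n + 1) ^ 2 * ‖M‖ ^ n := by
        gcongr
        exact one_le_pow₀ (by simp)
  refine ⟨‖M‖, norm_nonneg M, hbd, ‖M‖ + ‖M‖, by positivity, fun f => ?_⟩
  have hk := hV.isAnalyticOnDisc_weight
  have h1 : dDeriv k * f = dDeriv (M f) - k * dDeriv f := by
    have h2 : (M f : 𝔻 → ℂ) = k * f := funext fun z => hM f z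
    rw [h2, dDeriv_mul hk f.isAnalytic]
    ring
  have h3 := isBergman_and_bergmanNorm_le_mul hk f.isBergman_dDeriv (norm_nonneg M) hbd
  rw [h1]
  refine ⟨(M f).isBergman_dDeriv.sub h3.1,
    (bergmanNorm_sub_le (M f).isBergman_dDeriv h3.1).trans ?_⟩
  rw [add_mul]
  refine add_le_add ((bergmanNorm_dDeriv_le _).trans (M.le_opNorm f)) (h3.2.trans ?_)
  gcongr
  exact f.bergmanNorm_dDeriv_le

end IsWeightedComposition

/-! ### The spectral radius -/

/-- A vertical arithmetic progression spends a bounded time in a disc around the origin. -/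
lemma card_le_of_forall_norm_lt {b R : ℝ} (hb : b ≠ 0) (w : ℂ) (t : Finset ℕ)
    (ht : ∀ j ∈ t, ‖w + (j * b : ℝ) * I‖ < R) : t.card ≤ ⌊2 * R / |b|⌋₊ + 1 := by
  rcases t.eq_empty_or_nonempty with rfl | hne
  · simp
  set m := t.min' hne
  have hm : m ∈ t := t.min'_mem hne
  have hsub : t ⊆ Finset.Icc m (m + ⌊2 * R / |b|⌋₊) := by
    intro j hj
    have hmj : m ≤ j := t.min'_le j hj
    refine Finset.mem_Icc.2 ⟨hmj, ?_⟩
    have h1 := norm_sub_le (w + (j * b : ℝ) * I) (w + (m * b : ℝ) * I)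
    have h2 : w + (j * b : ℝ) * I - (w + (m * b : ℝ) * I) = (((j - m : ℕ) * b : ℝ) : ℂ) * I := by
      push_cast [hmj]
      ring
    rw [h2, norm_mul, norm_I, mul_one, norm_real, Real.norm_eq_abs, abs_mul, Nat.abs_cast] at h1
    have h3 : ((j - m : ℕ) : ℝ) ≤ 2 * R / |b| := by
      rw [le_div_iff₀ (abs_pos.2 hb)]
      linarith [ht j hj, ht m hm]
    have h4 := Nat.le_floor h3
    omega
  refine (Finset.card_le_card hsub).trans ?_
  simp
  omega

/-- Only boundedly many points of an orbit stay away from the fixed point `a`, so products of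
values of `k` along an orbit grow at most like powers of any `ρ > |k(a)|`. -/
lemma exists_norm_prod_le {a : ℂ} (ha : ‖a‖ = 1) {b : ℝ} (hb : b ≠ 0) {k : 𝔻 → ℂ} {c : ℂ}
    (hc : Tendsto k (farFilter a) (𝓝 c)) {H : ℝ} (hH : ∀ z, ‖k z‖ ≤ H) {ρ : ℝ} (hρ : ‖c‖ < ρ) :
    ∃ K : ℝ, 0 ≤ K ∧ ∀ (s : Finset ℕ) (z : 𝔻),
      ‖∏ j ∈ s, k (parabolic a ha (j * b) z)‖ ≤ K * ρ ^ s.card := by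
  have hρ0 : 0 < ρ := (norm_nonneg c).trans_lt hρ
  obtain ⟨R, hR0, hR⟩ := exists_forall_norm_le_of_tendsto hc (sub_pos.2 hρ)
  set Q := max H ρ / ρ with hQ
  have hQ1 : 1 ≤ Q := (one_le_div hρ0).2 (le_max_right _ _)
  refine ⟨Q ^ (⌊2 * R / |b|⌋₊ + 1), by positivity, fun s z => ?_⟩
  have hfac : ∀ j ∈ s, ‖k (parabolic a ha (j * b) z)‖ ≤
      ρ * (if ‖cayley a z + (j * b : ℝ) * I‖ < R then Q else 1) := by
    intro j _
    split_ifs with hj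
    · rw [hQ, mul_div_cancel₀ _ hρ0.ne']
      exact (hH _).trans (le_max_left _ _)
    · rw [← cayley_parabolic ha, not_lt] at hj
      have h1 := hR _ hj
      have h2 := norm_le_norm_add_norm_sub' (k (parabolic a ha (j * b) z)) c
      linarith
  rw [norm_prod]
  refine (Finset.prod_le_prod (fun _ _ => norm_nonneg _) hfac).trans ?_
  rw [Finset.prod_mul_distrib, Finset.prod_const, mul_comm, ← Finset.prod_filter,
    Finset.prod_const]
  gcongr
  exact card_le_of_forall_norm_lt hb (cayley a z) _ fun j hj => (Finset.mem_filter.1 hj).2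

namespace IsWeightedComposition

variable {a : ℂ} {ha : ‖a‖ = 1} {b : ℝ} {k : 𝔻 → ℂ} {V : DirichletSpace →L[ℂ] DirichletSpace}

lemma pow_apply (hV : IsWeightedComposition k (parabolic a ha b) V) (n : ℕ) (f : DirichletSpace) :
    ((V ^ n) f : 𝔻 → ℂ) =
      (∏ j ∈ Finset.range n, k ∘ parabolic a ha (j * b)) * (f ∘ parabolic a ha (n * b)) := by
  induction n with
  | zero =>
    funext z
    simp [parabolic_zero]
  | succ n ih =>
    funext z
    rw [pow_succ', ContinuousLinearMap.mul_def, ContinuousLinearMap.comp_apply, hV, ih]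
    simp only [Pi.mul_apply, Finset.prod_apply, Function.comp_apply, ← parabolic_add]
    rw [Finset.prod_range_succ']
    have h1 : ∀ j : ℕ, (j : ℝ) * b + b = ((j + 1 : ℕ) : ℝ) * b := fun j => by push_cast; ring
    simp only [h1]
    simp [parabolic_zero]
    ring

/-- The term of the product rule in which the `j`-th factor is differentiated is carried back by
the conformal invariance of the area integral to a multiple of `k'`. -/
lemma bergmanNorm_dDeriv_comp_mul_le (hk : IsAnalyticOnDisc k) {B : ℝ} (hB0 : 0 ≤ B)
    (hB : ∀ f : DirichletSpace,
      IsBergman (dDeriv k * f) ∧ bergmanNorm (dDeriv k * f) ≤ B * ‖f‖)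
    {n j : ℕ} (hj : j < n) (f : DirichletSpace) :
    IsBergman (dDeriv (k ∘ parabolic a ha (j * b)) * (f ∘ parabolic a ha (n * b))) ∧
      bergmanNorm (dDeriv (k ∘ parabolic a ha (j * b)) * (f ∘ parabolic a ha (n * b))) ≤
        B * ((2 + n / (1 - ‖(parabolic a ha b 0 : ℂ)‖)) * ‖f‖) := by
  have hR : 0 < 1 - ‖(parabolic a ha b 0 : ℂ)‖ := by
    linarith [(parabolic a ha b 0).norm_lt_one]
  set g := compParabolic ha ((n - j : ℕ) * b) f with hg
  have hshift : ((n - j : ℕ) : ℝ) * b + j * b = n * b := by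
    push_cast [hj.le]
    ring
  have hfg : (f ∘ parabolic a ha (n * b)) = (g : 𝔻 → ℂ) ∘ parabolic a ha (j * b) := by
    funext z
    rw [Function.comp_apply, Function.comp_apply, hg, compParabolic_apply, ← parabolic_add,
      hshift]
  have hrw : dDeriv (k ∘ parabolic a ha (j * b)) * (f ∘ parabolic a ha (n * b)) =
      ((dDeriv k * (g : 𝔻 → ℂ)) ∘ parabolic a ha (j * b)) * dDeriv (coeMap (parabolic a ha (j * b))) := by
    rw [hfg, dDeriv_comp hk (isAnalyticOnDisc_parabolic ha _)]
    funext z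
    simp only [Pi.mul_apply, Function.comp_apply]
    ring
  have h1 := isBergman_and_bergmanNorm_comp (hB g).1 (parabolic a ha (j * b))
    (isAnalyticOnDisc_parabolic ha _)
  rw [hrw, h1.2]
  refine ⟨h1.1, (hB g).2.trans ?_⟩
  gcongr
  refine (norm_compParabolic_le ha b f (n - j)).trans ?_
  gcongr
  exact Nat.sub_le n j

/-- The powers of a weighted composition operator grow at most like `n² ρ ^ n`, for each
`ρ > |k(a)|`. -/
lemma exists_norm_pow_le (hV : IsWeightedComposition k (parabolic a ha b) V) (hb : b ≠ 0) {c : ℂ}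
    (hc : Tendsto k (farFilter a) (𝓝 c)) {ρ : ℝ} (hρ : ‖c‖ < ρ) :
    ∃ C : ℝ, ∀ n : ℕ, ‖V ^ n‖ ≤ C * (n + 1) ^ 2 * ρ ^ n := by
  have hρ0 : 0 < ρ := (norm_nonneg c).trans_lt hρ
  have hk := hV.isAnalyticOnDisc_weight
  obtain ⟨H, hH0, hH, B, hB0, hB⟩ := hV.exists_weight_bounds
  obtain ⟨K, hK0, hK⟩ := exists_norm_prod_le ha hb hc hH hρ
  have hR : 0 < 1 - ‖(parabolic a ha b 0 : ℂ)‖ := by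
    linarith [(parabolic a ha b 0).norm_lt_one]
  set L := 1 / (1 - ‖(parabolic a ha b 0 : ℂ)‖) with hL
  have hL0 : 0 ≤ L := by positivity
  refine ⟨K * (2 + L + ρ⁻¹ * B * (2 + L)), fun n => ?_⟩
  refine ContinuousLinearMap.opNorm_le_bound _ (by positivity) fun f => ?_
  have hanj : ∀ j : ℕ, IsAnalyticOnDisc (k ∘ parabolic a ha (j * b)) := fun j =>
    hk.comp (isAnalyticOnDisc_parabolic ha _)
  have hanprod : ∀ s : Finset ℕ, IsAnalyticOnDisc (∏ j ∈ s, k ∘ parabolic a ha (j * b)) :=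
    fun s => IsAnalyticOnDisc.prod fun j _ => hanj j
  have hfn := (compParabolic ha (n * b) f).isBergman_dDeriv
  have hKn : ∀ (s : Finset ℕ) (z : 𝔻),
      ‖(∏ j ∈ s, k ∘ parabolic a ha (j * b)) z‖ ≤ K * ρ ^ s.card := fun s z => by
    simpa [Finset.prod_apply] using hK s z
  have hzero : ‖(V ^ n) f 0‖ ≤ K * ρ ^ n * ((1 + n * L) * ‖f‖) := by
    rw [hV.pow_apply, Pi.mul_apply, norm_mul]
    have h1 := hKn (Finset.range n) 0
    rw [Finset.card_range] at h1
    refine mul_le_mul h1 ?_ (norm_nonneg _) (by positivity)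
    refine (norm_apply_parabolic_zero_le ha b f n).trans ?_
    rw [add_mul, one_mul, mul_assoc, hL, one_div, inv_mul_eq_div]
    gcongr
    · exact f.norm_apply_zero_le
    · exact f.bergmanNorm_dDeriv_le
  have hder : dDeriv ((V ^ n) f) =
      (∑ j ∈ Finset.range n, (∏ i ∈ (Finset.range n).erase j, k ∘ parabolic a ha (i * b)) *
        (dDeriv (k ∘ parabolic a ha (j * b)) * (f ∘ parabolic a ha (n * b)))) +
      (∏ j ∈ Finset.range n, k ∘ parabolic a ha (j * b)) *
        dDeriv (compParabolic ha (n * b) f) := by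
    rw [hV.pow_apply, dDeriv_mul (hanprod _) (f.isAnalytic.comp (isAnalyticOnDisc_parabolic ha _)),
      dDeriv_prod hanj, Finset.sum_mul]
    simp only [mul_assoc]
    rfl
  have hterm : ∀ j ∈ Finset.range n,
      IsBergman ((∏ i ∈ (Finset.range n).erase j, k ∘ parabolic a ha (i * b)) *
        (dDeriv (k ∘ parabolic a ha (j * b)) * (f ∘ parabolic a ha (n * b)))) ∧
      bergmanNorm ((∏ i ∈ (Finset.range n).erase j, k ∘ parabolic a ha (i * b)) *
        (dDeriv (k ∘ parabolic a ha (j * b)) * (f ∘ parabolic a ha (n * b)))) ≤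
        K * (ρ ^ n * ρ⁻¹) * (B * ((2 + n * L) * ‖f‖)) := by
    intro j hj
    have hjn := Finset.mem_range.1 hj
    have h1 := bergmanNorm_dDeriv_comp_mul_le (ha := ha) (b := b) hk hB0 hB hjn f
    have hcard : ρ ^ ((Finset.range n).erase j).card = ρ ^ n * ρ⁻¹ := by
      rw [Finset.card_erase_of_mem hj, Finset.card_range, pow_sub₀ _ hρ0.ne' (by omega), pow_one]
    have h2 := isBergman_and_bergmanNorm_le_mul (hanprod ((Finset.range n).erase j)) h1.1
      (A := K * (ρ ^ n * ρ⁻¹)) (by positivity) (by rw [← hcard]; exact hKn _)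
    refine ⟨h2.1, h2.2.trans ?_⟩
    refine mul_le_mul_of_nonneg_left (h1.2.trans_eq ?_) (by positivity)
    rw [hL]
    ring
  have hlast := isBergman_and_bergmanNorm_le_mul (hanprod (Finset.range n)) hfn
    (A := K * ρ ^ n) (by positivity) (by simpa using hKn (Finset.range n))
  rw [bergmanNorm_dDeriv_compParabolic] at hlast
  have hnorm : bergmanNorm (dDeriv ((V ^ n) f)) ≤
      n * (K * (ρ ^ n * ρ⁻¹) * (B * ((2 + n * L) * ‖f‖))) + K * ρ ^ n * ‖f‖ := by
    rw [hder]
    refine (bergmanNorm_add_le (isBergman_sum fun j hj => (hterm j hj).1) hlast.1).trans ?_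
    refine add_le_add ?_ (hlast.2.trans (by gcongr; exact f.bergmanNorm_dDeriv_le))
    refine (bergmanNorm_sum_le fun j hj => (hterm j hj).1).trans ?_
    refine (Finset.sum_le_card_nsmul _ _ _ fun j hj => (hterm j hj).2).trans_eq ?_
    rw [Finset.card_range, nsmul_eq_mul]
  have hn0 : (0 : ℝ) ≤ n := Nat.cast_nonneg n
  have e1 : 1 + n * L + 1 ≤ (2 + L) * ((n : ℝ) + 1) ^ 2 := by nlinarith [mul_nonneg hn0 hL0]
  have e2 : (n : ℝ) * (2 + n * L) ≤ (2 + L) * ((n : ℝ) + 1) ^ 2 := by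
    nlinarith [mul_nonneg hn0 hL0]
  calc ‖(V ^ n) f‖
      ≤ K * ρ ^ n * ((1 + n * L) * ‖f‖) +
        (n * (K * (ρ ^ n * ρ⁻¹) * (B * ((2 + n * L) * ‖f‖))) + K * ρ ^ n * ‖f‖) :=
        (norm_le_add _).trans (add_le_add hzero hnorm)
    _ = K * ρ ^ n * ‖f‖ * ((1 + n * L + 1) + ρ⁻¹ * B * (n * (2 + n * L))) := by ring
    _ ≤ K * ρ ^ n * ‖f‖ * ((2 + L) * ((n : ℝ) + 1) ^ 2 +
          ρ⁻¹ * B * ((2 + L) * ((n : ℝ) + 1) ^ 2)) := by gcongr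
    _ = K * (2 + L + ρ⁻¹ * B * (2 + L)) * (n + 1) ^ 2 * ρ ^ n * ‖f‖ := by ring

/-- The spectral radius of a weighted composition operator is at most `|k(a)|`. -/
lemma norm_le_of_mem_spectrum (hV : IsWeightedComposition k (parabolic a ha b) V) (hb : b ≠ 0)
    {c : ℂ} (hc : Tendsto k (farFilter a) (𝓝 c)) {l : ℂ} (hl : l ∈ spectrum ℂ V) :
    ‖l‖ ≤ ‖c‖ := by
  refine le_of_forall_gt_imp_ge_of_dense fun ρ hρ => ?_
  have hρ0 : 0 ≤ ρ := (norm_nonneg c).trans hρ.le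
  obtain ⟨C, hC⟩ := hV.exists_norm_pow_le hb hc hρ
  refine le_of_forall_pow_le (C := C * ‖(1 : DirichletSpace →L[ℂ] DirichletSpace)‖) hρ0
    fun n => ?_
  have h1 := spectrum.norm_le_norm_mul_of_mem (spectrum.pow_mem_pow V n hl)
  rw [norm_pow] at h1
  refine h1.trans ?_
  calc _ ≤ C * (n + 1) ^ 2 * ρ ^ n * ‖(1 : DirichletSpace →L[ℂ] DirichletSpace)‖ := by
        gcongr
        exact hC n
    _ = _ := by ring

end IsWeightedComposition

/-! ### The inverse operator -/

namespace IsWeightedComposition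

variable {a : ℂ} {ha : ‖a‖ = 1} {b : ℝ} {h : 𝔻 → ℂ} {W V : DirichletSpace →L[ℂ] DirichletSpace}

/-- The weight `V 1` of the inverse `V` is `1 / (h ∘ φ⁻¹)`. -/
lemma mul_inverse_one_eq_one (hW : IsWeightedComposition h (parabolic a ha b) W)
    (hWV : W * V = 1) (z : 𝔻) : h (parabolic a ha (-b) z) * V one z = 1 := by
  have h1 := hW (V one) (parabolic a ha (-b) z)
  rw [← ContinuousLinearMap.comp_apply, ← ContinuousLinearMap.mul_def, hWV,
    one_apply_eq_self, one_apply, parabolic_parabolic_neg] at h1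
  exact h1.symm

lemma inverse (hW : IsWeightedComposition h (parabolic a ha b) W) (hWV : W * V = 1) :
    IsWeightedComposition (V one) (parabolic a ha (-b)) V := by
  intro f z
  have h1 := hW (V f) (parabolic a ha (-b) z)
  rw [← ContinuousLinearMap.comp_apply, ← ContinuousLinearMap.mul_def, hWV,
    one_apply_eq_self, parabolic_parabolic_neg] at h1
  rw [h1, ← mul_assoc, mul_comm (V one z), hW.mul_inverse_one_eq_one hWV, one_mul]

lemma boundaryValue_ne_zero (hW : IsWeightedComposition h (parabolic a ha b) W)
    (hWV : W * V = 1) {c : ℂ} (hc : Tendsto h (farFilter a) (𝓝 c)) : c ≠ 0 := by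
  obtain ⟨H, hH0, hH, -⟩ := (hW.inverse hWV).exists_weight_bounds
  have hne := farFilter_neBot ha
  have h1 : 1 ≤ ‖c‖ * H := by
    refine ge_of_tendsto' (hc.norm.mul_const H) fun z => ?_
    have h2 := congrArg norm (hW.mul_inverse_one_eq_one hWV (parabolic a ha b z))
    rw [parabolic_neg_parabolic, norm_mul, norm_one] at h2
    rw [← h2]
    gcongr
    exact hH _
  rintro rfl
  norm_num at h1

lemma tendsto_inverse_weight (hW : IsWeightedComposition h (parabolic a ha b) W)
    (hWV : W * V = 1) {c : ℂ} (hc : Tendsto h (farFilter a) (𝓝 c)) :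
    Tendsto (V one) (farFilter a) (𝓝 c⁻¹) := by
  have h1 := (hc.comp (tendsto_parabolic_farFilter ha (-b))).inv₀
    (hW.boundaryValue_ne_zero hWV hc)
  refine h1.congr fun z => ?_
  exact inv_eq_of_mul_eq_one_right (hW.mul_inverse_one_eq_one hWV z)

/-- Applying the bound for the spectral radius to the operator and to its inverse. -/
lemma norm_eq_of_mem_spectrum (hW : IsWeightedComposition h (parabolic a ha b) W) (hb : b ≠ 0)
    (hinv : IsUnit W) {c : ℂ} (hc : Tendsto h (farFilter a) (𝓝 c)) {l : ℂ}
    (hl : l ∈ spectrum ℂ W) : ‖l‖ = ‖c‖ := by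
  obtain ⟨u, rfl⟩ := hinv
  have hWV : (u : DirichletSpace →L[ℂ] DirichletSpace) * (u⁻¹ : _ˣ) = 1 := u.mul_inv
  refine le_antisymm (hW.norm_le_of_mem_spectrum hb hc hl) ?_
  have h1 : l⁻¹ ∈ spectrum ℂ ((u⁻¹ : _ˣ) : DirichletSpace →L[ℂ] DirichletSpace) :=
    spectrum.inv₀_mem_inv_iff.2 hl
  have h2 := (hW.inverse hWV).norm_le_of_mem_spectrum (neg_ne_zero.2 hb)
    (hW.tendsto_inverse_weight hWV hc) h1
  have hl0 : l ≠ 0 := by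
    rintro rfl
    exact (spectrum.zero_mem_iff ℂ).1 hl u.isUnit
  rw [norm_inv, norm_inv] at h2
  exact (inv_le_inv₀ (norm_pos_iff.2 hl0)
    (norm_pos_iff.2 (hW.boundaryValue_ne_zero hWV hc))).1 h2

end IsWeightedComposition

/-! ### Approximate eigenvectors -/

/-- The singular inner function `exp (-s w)`, where `w` is the half-plane coordinate. It is an
eigenfunction of the translations, outside the Dirichlet space. -/
def innerFn (a : ℂ) (s : ℝ) (z : 𝔻) : ℂ := Complex.exp (-s * cayley a z)

/-- The function `1 / (1 + δ w)`, where `w` is the half-plane coordinate: it is close to `1` where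
`|w|` is much smaller than `1 / δ`, and decays at infinity. -/
def cutoff (a : ℂ) (δ : ℝ) (z : 𝔻) : ℂ := (1 + δ * cayley a z)⁻¹

/-- The approximate eigenvector `exp (-s w) / (1 + δ w)²`. The square makes its derivative
bounded on the disc. -/
def approxEigen (a : ℂ) (s δ : ℝ) : 𝔻 → ℂ := innerFn a s * cutoff a δ ^ 2

section Approx

variable {a : ℂ} (ha : ‖a‖ = 1) {s δ : ℝ}

include ha

lemma norm_two_mul_div (z : 𝔻) : ‖2 * a / (a - z) ^ 2‖ = ‖cayley a z + 1‖ ^ 2 / 2 := by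
  rw [cayley_add_one ha, norm_div, norm_div, norm_mul, norm_pow, ha]
  norm_num
  ring

lemma one_add_ne_zero (hδ : 0 ≤ δ) (z : 𝔻) : 1 + δ * cayley a z ≠ 0 := by
  intro h
  have h1 := congrArg Complex.re h
  simp at h1
  nlinarith [mul_nonneg hδ (cayley_re_pos ha z).le]

lemma norm_innerFn_le (hs : 0 ≤ s) (z : 𝔻) : ‖innerFn a s z‖ ≤ 1 := by
  rw [innerFn, norm_exp, Real.exp_le_one_iff]
  simpa using mul_nonneg hs (cayley_re_pos ha z).le

lemma norm_cutoff_le (hδ : 0 ≤ δ) (z : 𝔻) : ‖cutoff a δ z‖ ≤ 1 := by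
  rw [cutoff, norm_inv]
  refine inv_le_one_of_one_le₀ (le_trans ?_ (re_le_norm _))
  simpa using mul_nonneg hδ (cayley_re_pos ha z).le

lemma norm_approxEigen_le (hs : 0 ≤ s) (hδ : 0 ≤ δ) (z : 𝔻) : ‖approxEigen a s δ z‖ ≤ 1 := by
  rw [approxEigen, Pi.mul_apply, Pi.pow_apply, norm_mul, norm_pow]
  exact mul_le_one₀ (norm_innerFn_le ha hs z) (by positivity)
    (pow_le_one₀ (norm_nonneg _) (norm_cutoff_le ha hδ z))

/-- For `δ ≤ 1` one has `δ |1 + w| ≤ |1 + δ w|` on the right half-plane. -/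
lemma mul_norm_cutoff_le (hδ : 0 ≤ δ) (hδ1 : δ ≤ 1) (z : 𝔻) :
    δ * ‖cayley a z + 1‖ * ‖cutoff a δ z‖ ≤ 1 := by
  have h0 := one_add_ne_zero ha hδ z
  have hre := cayley_re_pos ha z
  rw [cutoff, norm_inv, ← div_eq_mul_inv, div_le_one (norm_pos_iff.2 h0)]
  refine le_of_sq_le_sq ?_ (norm_nonneg _)
  rw [mul_pow, ← normSq_eq_norm_sq, ← normSq_eq_norm_sq]
  simp only [normSq_apply, add_re, add_im, one_re, one_im, re_ofReal_mul, im_ofReal_mul]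
  nlinarith [mul_nonneg (mul_nonneg hδ (sub_nonneg.2 hδ1)) hre.le]

lemma hasDerivAt_innerFn (z : 𝔻) :
    HasDerivAt (fun x => Complex.exp (-s * cayley a x))
      (innerFn a s z * (-s * (2 * a / (a - z) ^ 2))) z :=
  ((hasDerivAt_cayley ha z).const_mul (-s : ℂ)).cexp

lemma isAnalyticOnDisc_innerFn : IsAnalyticOnDisc (innerFn a s) :=
  isAnalyticOnDisc_of_hasDerivAt (fun _ => rfl) (hasDerivAt_innerFn ha)

lemma dDeriv_innerFn (z : 𝔻) :
    dDeriv (innerFn a s) z = innerFn a s z * (-s * (2 * a / (a - z) ^ 2)) :=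
  dDeriv_eq_of_hasDerivAt (fun _ => rfl) (hasDerivAt_innerFn ha z)

lemma hasDerivAt_cutoff (hδ : 0 ≤ δ) (z : 𝔻) :
    HasDerivAt (fun x => (1 + δ * cayley a x)⁻¹)
      (-(δ * (2 * a / (a - z) ^ 2)) * cutoff a δ z ^ 2) z := by
  have h1 := (((hasDerivAt_cayley ha z).const_mul (δ : ℂ)).const_add 1).fun_inv
    (one_add_ne_zero ha hδ z)
  refine h1.congr_deriv ?_
  rw [cutoff, inv_pow, div_eq_mul_inv]

lemma isAnalyticOnDisc_cutoff (hδ : 0 ≤ δ) : IsAnalyticOnDisc (cutoff a δ) :=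
  isAnalyticOnDisc_of_hasDerivAt (fun _ => rfl) (hasDerivAt_cutoff ha hδ)

lemma dDeriv_cutoff (hδ : 0 ≤ δ) (z : 𝔻) :
    dDeriv (cutoff a δ) z = -(δ * (2 * a / (a - z) ^ 2)) * cutoff a δ z ^ 2 :=
  dDeriv_eq_of_hasDerivAt (fun _ => rfl) (hasDerivAt_cutoff ha hδ z)

lemma norm_dDeriv_cutoff (hδ : 0 ≤ δ) (z : 𝔻) :
    ‖dDeriv (cutoff a δ) z‖ = δ * (‖cayley a z + 1‖ ^ 2 / 2) * ‖cutoff a δ z‖ ^ 2 := by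
  rw [dDeriv_cutoff ha hδ, norm_mul, norm_neg, norm_mul, norm_two_mul_div ha, norm_pow, norm_real,
    Real.norm_of_nonneg hδ]

lemma isBergman_dDeriv_cutoff (hδ : 0 < δ) (hδ1 : δ ≤ 1) :
    IsBergman (dDeriv (cutoff a δ)) ∧ bergmanNorm (dDeriv (cutoff a δ)) ≤ 1 / (2 * δ) := by
  refine isBergman_and_bergmanNorm_le_of_bounded (isAnalyticOnDisc_cutoff ha hδ.le).dDeriv
    (by positivity) fun z => ?_
  rw [norm_dDeriv_cutoff ha hδ.le, le_div_iff₀ (by positivity)]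
  calc _ = (δ * ‖cayley a z + 1‖ * ‖cutoff a δ z‖) ^ 2 := by ring
    _ ≤ 1 := pow_le_one₀ (by positivity) (mul_norm_cutoff_le ha hδ.le hδ1 z)

lemma isAnalyticOnDisc_approxEigen (hδ : 0 ≤ δ) : IsAnalyticOnDisc (approxEigen a s δ) := by
  have h1 := isAnalyticOnDisc_cutoff ha hδ
  rw [approxEigen, sq]
  exact (isAnalyticOnDisc_innerFn ha).mul (h1.mul h1)

lemma dDeriv_approxEigen (hδ : 0 ≤ δ) (z : 𝔻) :
    dDeriv (approxEigen a s δ) z = dDeriv (innerFn a s) z * cutoff a δ z ^ 2 +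
      innerFn a s z * (2 * cutoff a δ z * dDeriv (cutoff a δ) z) := by
  have h1 := isAnalyticOnDisc_cutoff ha hδ
  rw [approxEigen, sq, dDeriv_mul (isAnalyticOnDisc_innerFn ha) (h1.mul h1), dDeriv_mul h1 h1]
  simp only [Pi.add_apply, Pi.mul_apply]
  ring

lemma norm_dDeriv_approxEigen_le (hs : 0 ≤ s) (hδ : 0 ≤ δ) (z : 𝔻) :
    ‖dDeriv (approxEigen a s δ) z‖ ≤
      (s / 2 + δ) * (‖cayley a z + 1‖ ^ 2 * ‖cutoff a δ z‖ ^ 2) := by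
  have hG := norm_innerFn_le ha hs z
  have ht := norm_cutoff_le ha hδ z
  have h1 : ‖dDeriv (innerFn a s) z‖ ≤ s * (‖cayley a z + 1‖ ^ 2 / 2) := by
    rw [dDeriv_innerFn ha, norm_mul, norm_mul, norm_two_mul_div ha, norm_neg, norm_real,
      Real.norm_of_nonneg hs]
    exact mul_le_of_le_one_left (by positivity) hG
  rw [dDeriv_approxEigen ha hδ]
  calc _ ≤ ‖dDeriv (innerFn a s) z‖ * ‖cutoff a δ z‖ ^ 2 +
        ‖innerFn a s z‖ * (2 * ‖cutoff a δ z‖ * ‖dDeriv (cutoff a δ) z‖) := by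
        refine (norm_add_le _ _).trans_eq ?_
        simp only [norm_mul, norm_pow]
        norm_num
    _ ≤ s * (‖cayley a z + 1‖ ^ 2 / 2) * ‖cutoff a δ z‖ ^ 2 +
        1 * (2 * 1 * (δ * (‖cayley a z + 1‖ ^ 2 / 2) * ‖cutoff a δ z‖ ^ 2)) := by
        rw [norm_dDeriv_cutoff ha hδ]
        gcongr
    _ = _ := by ring

lemma isBergman_dDeriv_approxEigen (hs : 0 ≤ s) (hδ : 0 < δ) (hδ1 : δ ≤ 1) :
    IsBergman (dDeriv (approxEigen a s δ)) := by
  refine (isBergman_and_bergmanNorm_le_of_bounded (isAnalyticOnDisc_approxEigen ha hδ.le).dDeriv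
    (C := (s / 2 + δ) * (1 / δ ^ 2)) (by positivity) fun z => ?_).1
  refine (norm_dDeriv_approxEigen_le ha hs hδ.le z).trans ?_
  gcongr
  rw [le_div_iff₀ (by positivity)]
  calc _ = (δ * ‖cayley a z + 1‖ * ‖cutoff a δ z‖) ^ 2 := by ring
    _ ≤ 1 := pow_le_one₀ (by positivity) (mul_norm_cutoff_le ha hδ.le hδ1 z)

/-- Away from the fixed point the derivatives are bounded uniformly in `δ`. -/
lemma norm_dDeriv_approxEigen_le_of_norm_lt (hs : 0 ≤ s) (hδ : 0 ≤ δ) (hδ1 : δ ≤ 1) {R : ℝ}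
    {z : 𝔻} (hz : ‖cayley a z‖ < R) :
    ‖dDeriv (approxEigen a s δ) z‖ ≤ (s / 2 + 1) * (R + 1) ^ 2 := by
  refine (norm_dDeriv_approxEigen_le ha hs hδ z).trans ?_
  have h1 : ‖cayley a z + 1‖ ≤ R + 1 := by
    refine (norm_add_le _ _).trans ?_
    rw [norm_one]
    linarith
  have h2 : ‖cutoff a δ z‖ ^ 2 ≤ 1 := pow_le_one₀ (norm_nonneg _) (norm_cutoff_le ha hδ z)
  calc _ ≤ (s / 2 + 1) * ((R + 1) ^ 2 * 1) := by gcongr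
    _ = _ := by ring

omit ha in
lemma volume_strip : volume {w : ℂ | 0 < w.re ∧ w.re < 1} = ⊤ := by
  have h1 := Complex.volume_preserving_equiv_real_prod.measure_preimage
    (s := Set.Ioo (0 : ℝ) 1 ×ˢ Set.univ) (measurableSet_Ioo.prod MeasurableSet.univ).nullMeasurableSet
  have h2 : Complex.measurableEquivRealProd ⁻¹' (Set.Ioo (0 : ℝ) 1 ×ˢ Set.univ) =
      {w : ℂ | 0 < w.re ∧ w.re < 1} := by
    ext w
    simp [Complex.measurableEquivRealProd_apply]
  rw [← h2, h1, Measure.volume_eq_prod, Measure.prod_prod]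
  simp

/-- In the half-plane model the area integral of `|(exp (-s w))'|²` is the integral of
`s² exp (-2 s Re w)`, which diverges already over the strip `0 < Re w < 1`. -/
lemma not_isBergman_dDeriv_innerFn (hs : 0 < s) : ¬ IsBergman (dDeriv (innerFn a s)) := by
  intro hB
  have h1 := hB.ofReal_bergmanNorm_sq
  have hd : DifferentiableOn ℂ (cayley a) (Metric.ball 0 1) :=
    forall_mem_ball fun z => (hasDerivAt_cayley ha z).differentiableAt.differentiableWithinAt
  have hinj : Set.InjOn (cayley a) (Metric.ball 0 1) :=
    forall_mem_ball fun z => forall_mem_ball fun w h => by rw [cayley_injective ha h]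
  have himg : {w : ℂ | 0 < w.re ∧ w.re < 1} ⊆ cayley a '' Metric.ball 0 1 := fun w hw =>
    ⟨cayleyInv a w, by simpa using norm_cayleyInv_lt_one ha hw.1, cayley_cayleyInv ha hw.1⟩
  set F : ℂ → ENNReal := fun w => ‖(s : ℂ) * Complex.exp (-s * w)‖ₑ ^ 2 with hF
  have h2 : ∫⁻ z in Metric.ball 0 1, ‖discExt (dDeriv (innerFn a s)) z‖ₑ ^ 2 =
      ∫⁻ w in cayley a '' Metric.ball 0 1, F w := by
    rw [lintegral_image_ball hd hinj]
    refine setLIntegral_congr_fun Metric.isOpen_ball.measurableSet (forall_mem_ball fun z => ?_)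
    simp only [discExt_coe, hF]
    rw [dDeriv_innerFn ha, (hasDerivAt_cayley ha z).deriv, ← mul_pow, ← enorm_mul, innerFn,
      ← enorm_neg]
    congr 2
    ring
  have h3 : (⊤ : ENNReal) ≤ ∫⁻ w in cayley a '' Metric.ball 0 1, F w := by
    have hmeas : MeasurableSet {w : ℂ | 0 < w.re ∧ w.re < 1} :=
      (measurableSet_lt measurable_const measurable_re).inter
        (measurableSet_lt measurable_re measurable_const)
    calc (⊤ : ENNReal) = ENNReal.ofReal ((s * Real.exp (-s)) ^ 2) *
          volume {w : ℂ | 0 < w.re ∧ w.re < 1} := by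
          rw [volume_strip, ENNReal.mul_top]
          simpa using by positivity
      _ = ∫⁻ _ in {w : ℂ | 0 < w.re ∧ w.re < 1}, ENNReal.ofReal ((s * Real.exp (-s)) ^ 2) := by
          rw [setLIntegral_const]
      _ ≤ ∫⁻ w in {w : ℂ | 0 < w.re ∧ w.re < 1}, F w := by
          refine setLIntegral_mono' hmeas fun w hw => ?_
          rw [hF]
          simp only
          rw [← ofReal_norm, ENNReal.ofReal_pow (by positivity), norm_mul, norm_exp, norm_real,
            Real.norm_of_nonneg hs.le]
          gcongr
          have : (-(s : ℂ) * w).re = -s * w.re := by simp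
          rw [this]
          nlinarith [hw.2]
      _ ≤ _ := lintegral_mono_set himg
  rw [lintegral_discArea, h2, top_le_iff.1 h3, ENNReal.mul_top (by simp)] at h1
  exact ENNReal.ofReal_ne_top h1

/-- The derivatives of the approximate eigenvectors are unbounded in the Bergman space as
`δ → 0`, because their pointwise limit is not square integrable. -/
lemma not_eventually_bergmanNorm_dDeriv_approxEigen_le (hs : 0 < s) {B : ℝ} (hB : 0 ≤ B) :
    ¬ ∀ᶠ n : ℕ in atTop, bergmanNorm (dDeriv (approxEigen a s (1 / ((n : ℝ) + 1)))) ≤ B := by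
  intro hev
  have hδ : ∀ n : ℕ, 0 < 1 / ((n : ℝ) + 1) := fun n => Nat.one_div_pos_of_nat
  have hδ1 : ∀ n : ℕ, 1 / ((n : ℝ) + 1) ≤ 1 := fun n => by
    rw [div_le_one (by positivity)]
    simp
  refine not_isBergman_dDeriv_innerFn ha hs (isBergman_of_tendsto
    (fun n => isBergman_dDeriv_approxEigen ha hs.le (hδ n) (hδ1 n))
    (isAnalyticOnDisc_innerFn ha).dDeriv (fun z => ?_) hB hev).1
  have hlim : Tendsto (fun n : ℕ => ((1 / ((n : ℝ) + 1) : ℝ) : ℂ)) atTop (𝓝 0) := by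
    rw [← Complex.ofReal_zero]
    exact (Complex.continuous_ofReal.tendsto 0).comp
      (tendsto_one_div_add_atTop_nhds_zero_nat (𝕜 := ℝ))
  have ht : Tendsto (fun n : ℕ => cutoff a (1 / ((n : ℝ) + 1)) z) atTop (𝓝 1) := by
    have h1 := ((hlim.mul_const (cayley a z)).const_add 1).inv₀ (by simp)
    simp only [zero_mul, add_zero, inv_one] at h1
    exact h1
  have ht' : Tendsto (fun n : ℕ => dDeriv (cutoff a (1 / ((n : ℝ) + 1))) z) atTop (𝓝 0) := by
    have h1 := (hlim.mul_const (2 * a / (a - z) ^ 2)).neg.mul (ht.pow 2)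
    simp only [zero_mul, neg_zero] at h1
    exact h1.congr fun n => (dDeriv_cutoff ha (hδ n).le z).symm
  have h2 := ((ht.pow 2).const_mul (dDeriv (innerFn a s) z)).add
    (((ht.const_mul 2).mul ht').const_mul (innerFn a s z))
  simp only [one_pow, mul_one, mul_zero, add_zero] at h2
  exact h2.congr fun n => (dDeriv_approxEigen ha (hδ n).le z).symm

end Approx

section Residual

variable {a : ℂ} (ha : ‖a‖ = 1) {s δ : ℝ}

lemma innerFn_parabolic (b : ℝ) (z : 𝔻) :
    innerFn a s (parabolic a ha b z) = Complex.exp (-s * (b * I)) * innerFn a s z := by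
  rw [innerFn, cayley_parabolic, innerFn, ← Complex.exp_add]
  congr 1
  ring

lemma cutoff_parabolic_sub (hδ : 0 ≤ δ) (b : ℝ) (z : 𝔻) :
    cutoff a δ (parabolic a ha b z) - cutoff a δ z =
      -(δ * b * I) * (cutoff a δ z * cutoff a δ (parabolic a ha b z)) := by
  have h1 := one_add_ne_zero ha hδ z
  have h2 := one_add_ne_zero ha hδ (parabolic a ha b z)
  rw [cutoff, cutoff, inv_sub_inv h2 h1, ← mul_inv, div_eq_mul_inv, mul_comm (1 + _ : ℂ)]
  congr 1
  rw [cayley_parabolic]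
  ring

/-- The factor `e` in `g ∘ φ - μ g = -i δ b e`, for the approximate eigenvector `g` and the
translation `φ` by `b i`, where `μ = exp (-i s b)`. -/
def approxError (a : ℂ) (ha : ‖a‖ = 1) (s δ b : ℝ) : 𝔻 → ℂ :=
  Complex.exp (-s * (b * I)) • (cutoff a δ ∘ parabolic a ha b * approxEigen a s δ) +
    cutoff a δ * (approxEigen a s δ ∘ parabolic a ha b)

lemma approxEigen_parabolic (hδ : 0 ≤ δ) (b : ℝ) :
    approxEigen a s δ ∘ parabolic a ha b = Complex.exp (-s * (b * I)) • approxEigen a s δ +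
      (-(δ * b * I) : ℂ) • approxError a ha s δ b := by
  funext z
  have h1 := cutoff_parabolic_sub ha hδ b z
  simp only [approxError, approxEigen, Function.comp_apply, Pi.mul_apply, Pi.add_apply,
    Pi.pow_apply, Pi.smul_apply, smul_eq_mul, innerFn_parabolic]
  linear_combination (Complex.exp (-s * (b * I)) * innerFn a s z *
    (cutoff a δ z + cutoff a δ (parabolic a ha b z))) * h1

lemma norm_exp_neg_mul_I (s b : ℝ) : ‖Complex.exp (-s * (b * I))‖ = 1 := by
  have : (-s * (b * I) : ℂ) = ((-s * b : ℝ) : ℂ) * I := by push_cast; ring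
  rw [this, Complex.norm_exp_ofReal_mul_I]

lemma norm_approxError_le (hs : 0 ≤ s) (hδ : 0 ≤ δ) (b : ℝ) (z : 𝔻) :
    ‖approxError a ha s δ b z‖ ≤ 2 := by
  have h1 := norm_approxEigen_le ha hs hδ
  have h2 := norm_cutoff_le ha hδ
  simp only [approxError, Pi.add_apply, Pi.smul_apply, Pi.mul_apply, Function.comp_apply,
    smul_eq_mul]
  refine (norm_add_le _ _).trans ?_
  rw [norm_mul, norm_exp_neg_mul_I, one_mul, norm_mul, norm_mul]
  have h3 := mul_le_one₀ (h2 (parabolic a ha b z)) (norm_nonneg _) (h1 z)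
  have h4 := mul_le_one₀ (h2 z) (norm_nonneg _) (h1 (parabolic a ha b z))
  linarith

lemma isBergman_dDeriv_mul {u v : 𝔻 → ℂ} (hu : IsAnalyticOnDisc u) (hv : IsAnalyticOnDisc v)
    (hu' : IsBergman (dDeriv u)) (hv' : IsBergman (dDeriv v)) (hu1 : ∀ z, ‖u z‖ ≤ 1)
    (hv1 : ∀ z, ‖v z‖ ≤ 1) :
    IsBergman (dDeriv (u * v)) ∧
      bergmanNorm (dDeriv (u * v)) ≤ bergmanNorm (dDeriv u) + bergmanNorm (dDeriv v) := by
  have h1 := isBergman_and_bergmanNorm_le_mul hv hu' zero_le_one hv1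
  have h2 := isBergman_and_bergmanNorm_le_mul hu hv' zero_le_one hu1
  rw [one_mul] at h1 h2
  rw [dDeriv_mul hu hv, mul_comm (dDeriv u)]
  exact ⟨h1.1.add h2.1, (bergmanNorm_add_le h1.1 h2.1).trans (add_le_add h1.2 h2.2)⟩

lemma isAnalyticOnDisc_approxError (hδ : 0 ≤ δ) (b : ℝ) :
    IsAnalyticOnDisc (approxError a ha s δ b) := by
  have hP := isAnalyticOnDisc_parabolic ha b
  have ht := isAnalyticOnDisc_cutoff ha hδ
  have hg := isAnalyticOnDisc_approxEigen (s := s) ha hδ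
  exact (((ht.comp hP).mul hg).smul _).add (ht.mul (hg.comp hP))

lemma isBergman_dDeriv_approxError (hs : 0 ≤ s) (hδ : 0 < δ) (hδ1 : δ ≤ 1) (b : ℝ) :
    IsBergman (dDeriv (approxError a ha s δ b)) ∧
      bergmanNorm (dDeriv (approxError a ha s δ b)) ≤
        2 * bergmanNorm (dDeriv (approxEigen a s δ)) + 1 / δ := by
  have hP := isAnalyticOnDisc_parabolic ha b
  have ht := isAnalyticOnDisc_cutoff ha hδ.le
  have hg := isAnalyticOnDisc_approxEigen (s := s) ha hδ.le
  have ht' := isBergman_dDeriv_cutoff ha hδ hδ1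
  have hg' := isBergman_dDeriv_approxEigen ha hs hδ hδ1
  have ht1 := norm_cutoff_le ha hδ.le
  have hg1 := norm_approxEigen_le ha hs hδ.le
  have htP := isBergman_and_bergmanNorm_dDeriv_comp ha ht ht'.1 b
  have hgP := isBergman_and_bergmanNorm_dDeriv_comp ha hg hg' b
  have h1 := isBergman_dDeriv_mul (ht.comp hP) hg htP.1 hg' (fun z => ht1 _) hg1
  have h2 := isBergman_dDeriv_mul ht (hg.comp hP) ht'.1 hgP.1 ht1 (fun z => hg1 _)
  rw [approxError, dDeriv_add (((ht.comp hP).mul hg).smul _) (ht.mul (hg.comp hP)), dDeriv_smul]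
  refine ⟨(h1.1.smul _).add h2.1, (bergmanNorm_add_le (h1.1.smul _) h2.1).trans ?_⟩
  rw [bergmanNorm_smul, norm_exp_neg_mul_I, one_mul]
  have h3 := h1.2
  have h4 := h2.2
  rw [htP.2] at h3
  rw [hgP.2] at h4
  have h5 := ht'.2
  have h6 : 1 / δ = 1 / (2 * δ) + 1 / (2 * δ) := by field_simp; norm_num
  linarith

/-- The approximate eigenvector as an element of the Dirichlet space. -/
def approxEigenvector (a : ℂ) (ha : ‖a‖ = 1) (s δ : ℝ) (hs : 0 ≤ s) (hδ : 0 < δ) (hδ1 : δ ≤ 1) :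
    DirichletSpace :=
  ofBergman (approxEigen a s δ) (isAnalyticOnDisc_approxEigen ha hδ.le)
    (isBergman_dDeriv_approxEigen ha hs hδ hδ1)

end Residual

namespace IsWeightedComposition

variable {a : ℂ} {ha : ‖a‖ = 1} {b : ℝ} {h : 𝔻 → ℂ} {W : DirichletSpace →L[ℂ] DirichletSpace}

/-- The residual of the approximate eigenvector `g` for the eigenvalue `c μ` is
`h (g ∘ φ - μ g) + μ (h - c) g`. The terms with `h'` stay bounded because `|g| ≤ 1`, and
`(h - c) g'` is small near the fixed point and bounded elsewhere. -/
lemma exists_norm_residual_le (hW : IsWeightedComposition h (parabolic a ha b) W) {c : ℂ}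
    (hc : Tendsto h (farFilter a) (𝓝 c)) {s : ℝ} (hs : 0 ≤ s) :
    ∃ A : ℝ, 0 ≤ A ∧ ∀ ε > 0, ∃ C : ℝ, 0 ≤ C ∧ ∀ (δ : ℝ) (hδ : 0 < δ) (hδ1 : δ ≤ 1),
      ‖W (approxEigenvector a ha s δ hs hδ hδ1) -
        (c * Complex.exp (-s * (b * I))) • approxEigenvector a ha s δ hs hδ hδ1‖ ≤
        (A * δ + ε) * bergmanNorm (dDeriv (approxEigen a s δ)) + C := by
  obtain ⟨H, hH0, hH, -⟩ := hW.exists_weight_bounds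
  have hh := hW.isAnalyticOnDisc_weight
  have hh' : IsBergman (dDeriv h) := by
    rw [hW.weight_eq]
    exact (W one).isBergman_dDeriv
  set N := bergmanNorm (dDeriv h) with hN
  have hN0 : 0 ≤ N := bergmanNorm_nonneg _
  refine ⟨2 * |b| * H, by positivity, fun ε hε => ?_⟩
  obtain ⟨R, hR0, hR⟩ := exists_forall_norm_le_of_tendsto hc hε
  refine ⟨(H + ‖c‖) + ((|b| * (2 * N) + |b| * H) + (N + (H + ‖c‖) * ((s / 2 + 1) * (R + 1) ^ 2))),
    by positivity, fun δ hδ hδ1 => ?_⟩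
  set μ := Complex.exp (-s * (b * I)) with hμ
  have hμ1 : ‖μ‖ = 1 := norm_exp_neg_mul_I s b
  set v := approxEigenvector a ha s δ hs hδ hδ1 with hv
  set g := approxEigen a s δ with hg
  set e := approxError a ha s δ b with he
  have hvg : (v : 𝔻 → ℂ) = g := rfl
  have hgan : IsAnalyticOnDisc g := isAnalyticOnDisc_approxEigen ha hδ.le
  have hg' : IsBergman (dDeriv g) := isBergman_dDeriv_approxEigen ha hs hδ hδ1
  have hg1 : ∀ z, ‖g z‖ ≤ 1 := norm_approxEigen_le ha hs hδ.le
  have hean : IsAnalyticOnDisc e := isAnalyticOnDisc_approxError ha hδ.le b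
  have he' := isBergman_dDeriv_approxError ha hs hδ hδ1 b
  rw [← he, ← hg] at he'
  have he2 : ∀ z, ‖e z‖ ≤ 2 := norm_approxError_le ha hs hδ.le b
  have hhc : IsAnalyticOnDisc (h - fun _ => c) := hh.sub (isAnalyticOnDisc_const c)
  have hhcd : dDeriv (h - fun _ => c) = dDeriv h := by
    rw [dDeriv_sub hh (isAnalyticOnDisc_const c), dDeriv_const, sub_zero]
  have hhcb : ∀ z, ‖h z - c‖ ≤ H + ‖c‖ := fun z => (norm_sub_le _ _).trans (by gcongr; exact hH z)
  have hres : ((W v - (c * μ) • v : DirichletSpace) : 𝔻 → ℂ) =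
      (-(δ * b * I) : ℂ) • (h * e) + μ • ((h - fun _ => c) * g) := by
    funext z
    have h1 := congrFun (approxEigen_parabolic (s := s) ha hδ.le b) z
    simp only [Function.comp_apply, Pi.add_apply, Pi.smul_apply, smul_eq_mul] at h1
    rw [coe_sub, Pi.sub_apply, hW, coe_smul, hvg]
    simp only [Pi.add_apply, Pi.smul_apply, Pi.mul_apply, Pi.sub_apply, smul_eq_mul]
    linear_combination h z * h1
  have hd : dDeriv (W v - (c * μ) • v : DirichletSpace) =
      (-(δ * b * I) : ℂ) • (e * dDeriv h + h * dDeriv e) +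
        μ • (g * dDeriv h + (h - fun _ => c) * dDeriv g) := by
    rw [hres, dDeriv_add ((hh.mul hean).smul _) ((hhc.mul hgan).smul _), dDeriv_smul, dDeriv_smul,
      dDeriv_mul hh hean, dDeriv_mul hhc hgan, hhcd, mul_comm (dDeriv h) e, mul_comm (dDeriv h) g]
  have b1 := isBergman_and_bergmanNorm_le_mul hean hh' zero_le_two he2
  have b2 := isBergman_and_bergmanNorm_le_mul hh he'.1 hH0 hH
  have b3 := isBergman_and_bergmanNorm_le_mul hgan hh' zero_le_one hg1
  have b4 := isBergman_and_bergmanNorm_le (hhc.mul hg'.1) hg' hε.le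
    (C := (H + ‖c‖) * ((s / 2 + 1) * (R + 1) ^ 2)) (by positivity) fun z => by
      rw [Pi.mul_apply, norm_mul, Pi.sub_apply]
      by_cases hz : ‖cayley a z‖ < R
      · have h1 := norm_dDeriv_approxEigen_le_of_norm_lt ha hs hδ.le hδ1 hz
        calc ‖h z - c‖ * ‖dDeriv g z‖ ≤ (H + ‖c‖) * ((s / 2 + 1) * (R + 1) ^ 2) := by
              gcongr
              exact hhcb z
          _ ≤ _ := le_add_of_nonneg_left (by positivity)
      · have h1 := hR z (not_lt.1 hz)
        calc ‖h z - c‖ * ‖dDeriv g z‖ ≤ ε * ‖dDeriv g z‖ := by gcongr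
          _ ≤ _ := le_add_of_nonneg_right (by positivity)
  have hzero : ‖(W v - (c * μ) • v : DirichletSpace) 0‖ ≤ H + ‖c‖ := by
    rw [coe_sub, Pi.sub_apply, hW, coe_smul, hvg, Pi.smul_apply, smul_eq_mul]
    refine (norm_sub_le _ _).trans ?_
    rw [norm_mul, norm_mul, norm_mul, hμ1, mul_one]
    exact add_le_add ((mul_le_of_le_one_right (norm_nonneg _) (hg1 _)).trans (hH _))
      (mul_le_of_le_one_right (norm_nonneg c) (hg1 _))
  have hδb : ‖(-(δ * b * I) : ℂ)‖ = δ * |b| := by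
    rw [norm_neg, norm_mul, norm_I, mul_one, norm_mul, norm_real, norm_real,
      Real.norm_of_nonneg hδ.le, Real.norm_eq_abs]
  have b12 := bergmanNorm_add_le b1.1 b2.1
  have b34 := bergmanNorm_add_le b3.1 b4.1
  have hX := bergmanNorm_nonneg (dDeriv g)
  set X := bergmanNorm (dDeriv g) with hXdef
  have hsum : bergmanNorm (dDeriv (W v - (c * μ) • v : DirichletSpace)) ≤
      δ * |b| * (2 * N + H * (2 * X + 1 / δ)) +
        (1 * N + (ε * X + (H + ‖c‖) * ((s / 2 + 1) * (R + 1) ^ 2))) := by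
    rw [hd]
    refine (bergmanNorm_add_le ((b1.1.add b2.1).smul _) ((b3.1.add b4.1).smul _)).trans ?_
    rw [bergmanNorm_smul, bergmanNorm_smul, hδb, hμ1, one_mul]
    refine add_le_add ?_ (b34.trans (add_le_add b3.2 b4.2))
    refine mul_le_mul_of_nonneg_left (b12.trans (add_le_add b1.2 (b2.2.trans ?_))) (by positivity)
    exact mul_le_mul_of_nonneg_left he'.2 hH0
  have hδN : δ * |b| * (2 * N) ≤ |b| * (2 * N) := by
    rw [mul_assoc]
    exact mul_le_of_le_one_left (by positivity) hδ1
  have hexp : δ * |b| * (2 * N + H * (2 * X + 1 / δ)) =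
      δ * |b| * (2 * N) + 2 * |b| * H * δ * X + |b| * H := by
    field_simp
    ring
  rw [hexp] at hsum
  have hfin := norm_le_add (W v - (c * μ) • v)
  nlinarith

/-- The points `c exp (-i s b)`, `s > 0`, are approximate eigenvalues. -/
lemma mul_exp_mem_spectrum (hW : IsWeightedComposition h (parabolic a ha b) W) {c : ℂ}
    (hc : Tendsto h (farFilter a) (𝓝 c)) {s : ℝ} (hs : 0 < s) :
    c * Complex.exp (-s * (b * I)) ∈ spectrum ℂ W := by
  set l := c * Complex.exp (-s * (b * I)) with hl
  intro hunit
  obtain ⟨u, hu⟩ := hunit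
  set κ := ‖((u⁻¹ : _ˣ) : DirichletSpace →L[ℂ] DirichletSpace)‖ + 1 with hκ
  have hκ0 : 0 < κ := by positivity
  have hbelow : ∀ f : DirichletSpace, ‖f‖ ≤ κ * ‖W f - l • f‖ := by
    intro f
    have h1 : f = ((u⁻¹ : _ˣ) : DirichletSpace →L[ℂ] DirichletSpace)
        ((u : DirichletSpace →L[ℂ] DirichletSpace) f) := by
      rw [← ContinuousLinearMap.comp_apply, ← ContinuousLinearMap.mul_def, u.inv_mul,
        one_apply_eq_self]
    have h2 : (u : DirichletSpace →L[ℂ] DirichletSpace) f = l • f - W f := by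
      rw [hu]
      rfl
    calc ‖f‖ ≤ ‖((u⁻¹ : _ˣ) : DirichletSpace →L[ℂ] DirichletSpace)‖ * ‖l • f - W f‖ := by
          conv_lhs => rw [h1, h2]
          exact ContinuousLinearMap.le_opNorm _ _
      _ ≤ κ * ‖W f - l • f‖ := by
          rw [norm_sub_rev]
          gcongr
          exact le_add_of_nonneg_right zero_le_one
  obtain ⟨A, hA0, hA⟩ := hW.exists_norm_residual_le hc hs.le
  obtain ⟨C, hC0, hC⟩ := hA (1 / (4 * κ)) (by positivity)
  refine not_eventually_bergmanNorm_dDeriv_approxEigen_le ha hs (B := 2 * (κ * C))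
    (by positivity) ?_
  have hsmall : ∀ᶠ n : ℕ in atTop, A * (1 / ((n : ℝ) + 1)) < 1 / (4 * κ) := by
    have h1 := (tendsto_one_div_add_atTop_nhds_zero_nat (𝕜 := ℝ)).const_mul A
    rw [mul_zero] at h1
    exact h1.eventually_lt_const (by positivity)
  filter_upwards [hsmall] with n hn
  have hδ : 0 < 1 / ((n : ℝ) + 1) := Nat.one_div_pos_of_nat
  have hδ1 : 1 / ((n : ℝ) + 1) ≤ 1 := by
    rw [div_le_one (by positivity)]
    simp
  set δ := 1 / ((n : ℝ) + 1) with hδdef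
  set X := bergmanNorm (dDeriv (approxEigen a s δ)) with hX
  have hX0 : 0 ≤ X := bergmanNorm_nonneg _
  have h1 : X ≤ κ * ((A * δ + 1 / (4 * κ)) * X + C) := by
    refine (bergmanNorm_dDeriv_le (approxEigenvector a ha s δ hs.le hδ hδ1)).trans
      ((hbelow _).trans ?_)
    gcongr
    exact hC δ hδ hδ1
  have h2 : κ * ((A * δ + 1 / (4 * κ)) * X + C) ≤
      κ * ((1 / (4 * κ) + 1 / (4 * κ)) * X + C) := by gcongr
  have h3 : κ * ((1 / (4 * κ) + 1 / (4 * κ)) * X + C) = X / 2 + κ * C := by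
    field_simp
    ring
  linarith

end IsWeightedComposition

/-- Every unimodular number is `exp (-i s b)` for some `s > 0`. -/
lemma exists_pos_exp_eq {b : ℝ} (hb : b ≠ 0) {m : ℂ} (hm : ‖m‖ = 1) :
    ∃ s : ℝ, 0 < s ∧ Complex.exp (-s * (b * I)) = m := by
  have hpi := Real.pi_pos
  have harg1 := Complex.neg_pi_lt_arg m
  have harg2 := Complex.arg_le_pi m
  have hexp : Complex.exp (m.arg * I) = m := by
    have := Complex.norm_mul_exp_arg_mul_I m
    rwa [hm, ofReal_one, one_mul] at this
  have hbC : (b : ℂ) ≠ 0 := ofReal_ne_zero.2 hb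
  rcases lt_or_gt_of_ne hb with hb | hb
  · refine ⟨(m.arg + 2 * Real.pi) / (-b), div_pos (by linarith) (by linarith), ?_⟩
    rw [← hexp, Complex.exp_eq_exp_iff_exists_int, hexp]
    refine ⟨1, ?_⟩
    push_cast
    field_simp
  · refine ⟨(2 * Real.pi - m.arg) / b, div_pos (by linarith) hb, ?_⟩
    rw [← hexp, Complex.exp_eq_exp_iff_exists_int, hexp]
    refine ⟨-1, ?_⟩
    push_cast
    field_simp
    ring

theorem theorem3p3 (φ : 𝔻 → 𝔻) (a : ℂ) (hφ : IsParabolicAut φ a)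
    (h : 𝔻 → ℂ) (hh : IsDirichletMultiplier h)
    (c : ℂ) (hc : HasBoundaryValue h a c)
    (W : DirichletSpace →L[ℂ] DirichletSpace) (hW : IsWeightedComposition h φ W)
    (hinv : IsUnit W) :
    spectrum ℂ W = {l : ℂ | ‖l‖ = ‖c‖} := by
  obtain ⟨ha, b, hb, hφb⟩ := hφ.exists_parabolic
  obtain rfl : φ = parabolic a ha b := funext hφb
  have hfar : Tendsto h (farFilter a) (𝓝 c) := hc.mono_left (farFilter_le ha)
  ext l
  refine ⟨fun hl => hW.norm_eq_of_mem_spectrum hb hinv hfar hl, fun hl => ?_⟩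
  have hc0 : c ≠ 0 := by
    obtain ⟨u, rfl⟩ := hinv
    exact hW.boundaryValue_ne_zero u.mul_inv hfar
  have hnorm : ‖l‖ = ‖c‖ := hl
  obtain ⟨s, hs, hsl⟩ := exists_pos_exp_eq hb (m := l / c) (by
    rw [norm_div, hnorm, div_self (norm_ne_zero_iff.2 hc0)])
  have h1 := hW.mul_exp_mem_spectrum hfar hs
  rwa [hsl, mul_div_cancel₀ _ hc0] at h1

end
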